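/- **Setting.** Let $d\ge 1$, $\mathbb S^d\subset\mathbb R^{d+1}$ the unit sphere with surface measure $\nu$, and $\mu$ the normalized Haar measure on $SO(d+1)$. For $l\ge 0$ let $\mathfrak B^l$ be the space of spherical harmonics of order $l$ (restrictions to $\mathbb S^d$ of complex harmonic homogeneous polynomials of degree $l$), $N(d,l)=\frac{(2l+d-1)(l+d-2)!}{l!\,(d-1)!}$ for $l\ge1$, $N(d,0)=1$ its dimension, and let $\{B^l_q:1\le q\le N(d,l)\}$ be an orthonormal basis of $\mathfrak B^l$ in $L^2(\nu)$. Let $X$ be $\mathbb S^d$-valued with density $f_X\in L^2(\nu)$, and $U$ be $SO(d+1)$-valued, independent of $X$, with density $f_U\in L^2(\mu)$. Put $Z=UX$ and let $Z_1,Z_2,\dots$ be i.i.d. copies of $Z$. Define $$\phi^l_q(f)=\int f\,\overline{B^l_q}\,d\nu,\qquad D^l_{qr}(u)=\int \overline{B^l_q(ux)}\,B^l_r(x)\,d\nu(x),\qquad \tilde\phi^l_{qr}(f_U)=\int f_U\,D^l_{qr}\,d\mu,$$ and assume that every matrix $\tilde\phi^l(f_U)=(\tilde\phi^l_{qr}(f_U))_{q,r}$,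 $l\ge 0$, is invertible. Let $(T_n)$ be positive reals with $T_n\to\infty$, and $$K_{T}(x,z)=\sum_{l=0}^{\lfloor T\rfloor}\sum_{q}\Big(\sum_{r}(\tilde\phi^l(f_U))^{-1}_{qr}\overline{B^l_r(z)}\Big)B^l_q(x),\qquad \hat f_X(x)=\frac1n\sum_{i=1}^n\mathrm{Re}\,K_{T_n}(x,Z_i).$$ Write $\|\cdot\|_{op}$ for the operator norm of complex matrices with respect to the Euclidean norm. For nonnegative sequences, $a_n\gtrsim b_n$ (equivalently $b_n\lesssim a_n$) means that $a_n\ge c\,b_n$ for some constant $c>0$ and all sufficiently large $n$, and $a_n\asymp b_n$ means $a_n\lesssim b_n\lesssim a_n$. **Theorem.** Assume that the Fourier–Laplace series converges pointwise to $f_X$, i.e. $\sum_{l=0}^{L}\sum_q\phi^l_q(f_X)B^l_q(x)\to f_X(x)$ as $L\to\infty$ for every $x\in\mathbb S^d$, and that one of the following three sets of conditions holds. 1. There are $\beta\ge0$, $c_1>0$ and $0\le q\le d$ with * $\|(\tilde\phi^l(f_U))^{-1}\|_{op}\le c_1 l^{\beta}$ for all $l\ge1$; * $T_n\asymp n^p$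 for some $0<p<1/(2d-q)$; * for each $x\in\mathbb S^d$, $E[(\mathrm{Re}\,K_{T_n}(x,Z))^2]\gtrsim T_n^{2\beta+q}$. 2. There are $\beta,\gamma,c_1>0$, $\alpha\in\mathbb R$ and $0\le q\le d$ with * $\|(\tilde\phi^l(f_U))^{-1}\|_{op}\le c_1 l^{\alpha}\exp(\gamma l^\beta)$ for all $l\ge1$; * $T_n\lesssim(\log n)^{1/\beta}$; * for each $x\in\mathbb S^d$ and $0<\eta<1$, $E[(\mathrm{Re}\,K_{T_n}(x,Z))^2]\gtrsim T_n^{2\alpha+q}\exp(2\gamma(\eta T_n)^\beta)$. 3. There are $\beta,\gamma,c_1>0$, $\alpha,\xi_1,\zeta\in\mathbb R$ and $0\le q\le d$ with * $\|(\tilde\phi^l(f_U))^{-1}\|_{op}\le c_1 l^{\alpha}\exp(\gamma l^\beta(\log l-\xi_1))$ for all $l\ge1$; * $T_n\lesssim(\log n/\log\log n)^{1/\beta}$; * for each $x\in\mathbb S^d$ and $0<\eta<1$, $E[(\mathrm{Re}\,K_{T_n}(x,Z))^2]\gtrsim T_n^{2\alpha+q}\exp(2\gamma(\eta T_n)^\beta(\log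 T_n-\zeta))$. Then, for all $x\in\mathbb S^d$, as $n\to\infty$, $$\sqrt n\cdot\frac{\hat f_X(x)-f_X(x)-\big(E[\mathrm{Re}\,K_{T_n}(x,Z)]-f_X(x)\big)}{\sqrt{\mathrm{Var}(\mathrm{Re}\,K_{T_n}(x,Z))}}\ \overset{d}{\longrightarrow}\ N(0,1).$$ -/

import Mathlib

open MeasureTheory ProbabilityTheory Filter Topology Asymptotics
open scoped ComplexConjugate

noncomputable section

namespace SphereDeconvolution

/-! ## The sphere and spherical harmonics -/

/-- The unit sphere of `ℝ^(d+1)`. -/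
abbrev Sph (d : ℕ) : Type := Metric.sphere (0 : EuclideanSpace ℝ (Fin (d + 1))) 1

/-- The surface measure of the sphere: `ν A = (d + 1) • Leb {t a : 0 < t < 1, a ∈ A}`, where
`d + 1 = area (sphere) / Leb (ball)`. -/
def nu (d : ℕ) : Measure (Sph d) :=
  (volume : Measure (EuclideanSpace ℝ (Fin (d + 1)))).toSphere

/-- The Laplacian on complex polynomials in `d + 1` variables. -/
def laplacian (d : ℕ) :
    MvPolynomial (Fin (d + 1)) ℂ →ₗ[ℂ] MvPolynomial (Fin (d + 1)) ℂ :=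
  ∑ i : Fin (d + 1),
    (MvPolynomial.pderiv i).toLinearMap ∘ₗ (MvPolynomial.pderiv i).toLinearMap

/-- Restriction of a complex polynomial in `d + 1` variables to the sphere. -/
def restrictToSphere (d : ℕ) : MvPolynomial (Fin (d + 1)) ℂ →ₗ[ℂ] (Sph d → ℂ) :=
  LinearMap.pi fun x => (MvPolynomial.aeval fun i => ((x.1 i : ℝ) : ℂ)).toLinearMap

/-- The spherical harmonics of order `l`: the restrictions to the sphere of the harmonic
homogeneous polynomials of degree `l`. -/
def harmonicSpace (d l : ℕ) : Submodule ℂ (Sph d → ℂ) :=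
  (MvPolynomial.homogeneousSubmodule (Fin (d + 1)) ℂ l ⊓ LinearMap.ker (laplacian d)).map
    (restrictToSphere d)

/-- `N(d,l) = (2l+d-1) (l+d-2)! / (l! (d-1)!)`, with `N(d,0) = 1`: the dimension of the space of
spherical harmonics of order `l` (for `d ≥ 1`). For `l ≥ 1` and `d ≥ 1` the subtractions do not
truncate and the division is exact. -/
def dimHarm (d l : ℕ) : ℕ :=
  if l = 0 then 1
  else (2 * l + d - 1) * (l + d - 2).factorial / (l.factorial * (d - 1).factorial)

/-- The inner product `⟨f, g⟩₂ = ∫ f conj(g) dν`. -/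
def innerL2 (d : ℕ) (f g : Sph d → ℂ) : ℂ := ∫ x, f x * conj (g x) ∂(nu d)

/-- `b` is an orthonormal basis of the space of spherical harmonics of order `l`. -/
structure IsHarmonicONB (d l : ℕ) (b : Fin (dimHarm d l) → Sph d → ℂ) : Prop where
  span_eq : Submodule.span ℂ (Set.range b) = harmonicSpace d l
  orthonormal : ∀ q r, innerL2 d (b q) (b r) = if q = r then 1 else 0

/-! ## The rotation group and its normalized Haar measure -/

/-- The special orthogonal group `SO(d+1)`. -/
abbrev SO (d : ℕ) : Type := Matrix.specialOrthogonalGroup (Fin (d + 1)) ℝ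

theorem SO.transpose_mul_self {d : ℕ} (u : SO d) : u.1.transpose * u.1 = 1 :=
  (Matrix.mem_orthogonalGroup_iff' _ _).1 (Matrix.mem_specialOrthogonalGroup_iff.1 u.2).1

theorem SO.coe_inv {d : ℕ} (u : SO d) : (u⁻¹).1 = u.1.transpose := rfl

instance SO.instIsTopologicalGroup (d : ℕ) : IsTopologicalGroup (SO d) where
  continuous_mul := by
    refine Continuous.subtype_mk ?_ _
    exact (continuous_subtype_val.comp continuous_fst).matrix_mul
      (continuous_subtype_val.comp continuous_snd)
  continuous_inv := by
    rw [Topology.IsInducing.subtypeVal.continuous_iff]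
    exact (continuous_subtype_val (p := fun A => A ∈
      Matrix.specialOrthogonalGroup (Fin (d + 1)) ℝ)).matrix_transpose

theorem SO.isCompact_carrier (d : ℕ) :
    IsCompact {A : Matrix (Fin (d + 1)) (Fin (d + 1)) ℝ |
      A ∈ Matrix.specialOrthogonalGroup (Fin (d + 1)) ℝ} := by
  have hset : {A : Matrix (Fin (d + 1)) (Fin (d + 1)) ℝ |
      A ∈ Matrix.specialOrthogonalGroup (Fin (d + 1)) ℝ}
      = {A | A.transpose * A = 1} ∩ {A | A.det = 1} := by
    ext A
    simp only [Set.mem_ofPred_eq, Set.mem_inter_iff, Matrix.mem_specialOrthogonalGroup_iff,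
      Matrix.mem_orthogonalGroup_iff']
  have hclosed : IsClosed ({A : Matrix (Fin (d + 1)) (Fin (d + 1)) ℝ |
      A.transpose * A = 1} ∩ {A | A.det = 1}) :=
    (isClosed_eq (continuous_id.matrix_transpose.matrix_mul continuous_id)
      continuous_const).inter (isClosed_eq continuous_id.matrix_det continuous_const)
  have hbox : IsCompact (Set.univ.pi fun _ : Fin (d + 1) =>
      Set.univ.pi fun _ : Fin (d + 1) => Set.Icc (-1 : ℝ) 1) :=
    isCompact_univ_pi fun _ => isCompact_univ_pi fun _ => isCompact_Icc
  rw [hset]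
  refine IsCompact.of_isClosed_subset hbox hclosed ?_
  rintro A ⟨hA, -⟩ i - j -
  have h1 : ∑ k, A k j * A k j = 1 := by
    have := congrFun (congrFun (show A.transpose * A = 1 from hA) j) j
    simpa [Matrix.mul_apply] using this
  have h2 : A i j * A i j ≤ 1 := by
    rw [← h1]
    exact Finset.single_le_sum (f := fun k => A k j * A k j)
      (fun k _ => mul_self_nonneg _) (Finset.mem_univ i)
  exact ⟨by nlinarith, by nlinarith⟩

instance SO.instCompactSpace (d : ℕ) : CompactSpace (SO d) :=
  isCompact_iff_compactSpace.1 (SO.isCompact_carrier d)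

instance SO.instMeasurableSpace (d : ℕ) : MeasurableSpace (SO d) := borel (SO d)

instance SO.instBorelSpace (d : ℕ) : BorelSpace (SO d) := ⟨rfl⟩

/-- The normalized Haar measure of `SO(d+1)`. -/
def muSO (d : ℕ) : Measure (SO d) := Measure.haarMeasure ⊤

/-- The matrix-vector product `u x`, as a point of the sphere. -/
def rot {d : ℕ} (u : SO d) (x : Sph d) : Sph d :=
  ⟨WithLp.toLp 2 (u.1.mulVec (WithLp.ofLp x.1)), by
    have hx : ‖x.1‖ ^ 2 = 1 := by simp
    have hy : ‖(WithLp.toLp 2 (u.1.mulVec (WithLp.ofLp x.1)) :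
        EuclideanSpace ℝ (Fin (d + 1)))‖ ^ 2 = 1 := by
      have key : (u.1.mulVec (WithLp.ofLp x.1)) ⬝ᵥ (u.1.mulVec (WithLp.ofLp x.1))
          = (WithLp.ofLp x.1) ⬝ᵥ (WithLp.ofLp x.1) := by
        rw [Matrix.dotProduct_mulVec, Matrix.vecMul_mulVec, SO.transpose_mul_self,
          Matrix.vecMul_one]
      rw [EuclideanSpace.real_norm_sq_eq] at hx ⊢
      simp only [dotProduct, ← sq] at key
      exact key.trans hx
    rw [mem_sphere_zero_iff_norm]
    exact (pow_eq_one_iff_of_nonneg (norm_nonneg _) two_ne_zero).1 hy⟩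

/-! ## Fourier transforms and the deconvolution estimator

`B l q` stands for the chosen orthonormal basis of spherical harmonics. -/

/-- The hyperspherical Fourier transform `φ^l_q(f) = ∫ f conj(B^l_q) dν`. -/
def sphFourier (d : ℕ) (B : (l : ℕ) → Fin (dimHarm d l) → Sph d → ℂ) (f : Sph d → ℂ)
    (l : ℕ) (q : Fin (dimHarm d l)) : ℂ :=
  ∫ x, f x * conj (B l q x) ∂(nu d)

/-- `D^l_{qr}(u) = ∫ conj(B^l_q(u x)) B^l_r(x) dν(x)`. -/
def rotCoeff (d : ℕ) (B : (l : ℕ) → Fin (dimHarm d l) → Sph d → ℂ) (l : ℕ)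
    (q r : Fin (dimHarm d l)) (u : SO d) : ℂ :=
  ∫ x, conj (B l q (rot u x)) * B l r x ∂(nu d)

/-- The rotational Fourier transform of `g` at degree `l`: the matrix with entries
`∫ g D^l_{qr} dμ`. -/
def rotFourier (d : ℕ) (B : (l : ℕ) → Fin (dimHarm d l) → Sph d → ℂ) (g : SO d → ℂ) (l : ℕ) :
    Matrix (Fin (dimHarm d l)) (Fin (dimHarm d l)) ℂ :=
  Matrix.of fun q r => ∫ u, g u * rotCoeff d B l q r u ∂(muSO d)

/-- The operator norm of a complex matrix for the Euclidean norm of `ℂ^N`. -/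
def opNorm {N : ℕ} (A : Matrix (Fin N) (Fin N) ℂ) : ℝ :=
  ‖Matrix.toEuclideanCLM (n := Fin N) (𝕜 := ℂ) A‖

/-- The Fourier-Laplace series of `f` converges pointwise to `f`. -/
def FourierLaplaceConverges (d : ℕ) (B : (l : ℕ) → Fin (dimHarm d l) → Sph d → ℂ)
    (f : Sph d → ℝ) : Prop :=
  ∀ x, Tendsto
    (fun L : ℕ => ∑ l ∈ Finset.range L, ∑ q, sphFourier d B (fun y => (f y : ℂ)) l q * B l q x)
    atTop (𝓝 (f x : ℂ))

/-- The deconvolution kernel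
`K_T(x,z) = ∑_{0 ≤ l ≤ T} ∑_q (∑_r (φ̃^l(g))⁻¹_{qr} conj(B^l_r(z))) B^l_q(x)`,
where `g` is the density of the measurement error. -/
def kernelK (d : ℕ) (B : (l : ℕ) → Fin (dimHarm d l) → Sph d → ℂ) (g : SO d → ℝ) (T : ℝ)
    (x z : Sph d) : ℂ :=
  ∑ l ∈ Finset.range (⌊T⌋₊ + 1), ∑ q,
    (∑ r, (rotFourier d B (fun u => (g u : ℂ)) l)⁻¹ q r * conj (B l r z)) * B l q x

/-- The deconvolution density estimator `f̂(x) = n⁻¹ ∑_{i=1}^n Re K_T(x, Z_i)` computed from the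
observations `z 0, …, z (n-1)`. -/
def fhat (d : ℕ) (B : (l : ℕ) → Fin (dimHarm d l) → Sph d → ℂ) (g : SO d → ℝ) (T : ℝ) (n : ℕ)
    (z : ℕ → Sph d) (x : Sph d) : ℝ :=
  (n : ℝ)⁻¹ * ∑ i ∈ Finset.range n, (kernelK d B g T x (z i)).re

/-- The operator norm of `(φ̃^l(g))⁻¹`, as a function of `l`. -/
def invNorm (d : ℕ) (B : (l : ℕ) → Fin (dimHarm d l) → Sph d → ℂ) (g : SO d → ℝ) (l : ℕ) : ℝ :=
  opNorm (rotFourier d B (fun u => (g u : ℂ)) l)⁻¹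

/-- The second moment `E((Re K_{T_n}(x,Z))²)`, as a function of `x` and `n`. -/
def secondMoment (d : ℕ) (B : (l : ℕ) → Fin (dimHarm d l) → Sph d → ℂ) (g : SO d → ℝ)
    {Ω : Type*} [MeasurableSpace Ω] (P : Measure Ω) (Z : Ω → Sph d) (T : ℕ → ℝ)
    (x : Sph d) (n : ℕ) : ℝ :=
  ∫ ω, (kernelK d B g (T n) x (Z ω)).re ^ 2 ∂P

/-! ## Smoothness scenarios, truncation speeds and lower bounds

`s l` stands for the operator norm of `(φ̃^l(f_U))⁻¹`, and `M x n` for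
`E((Re K_{T_n}(x,Z))²)`. For positive sequences, `a =O[atTop] b` is `a_n ≲ b_n` and
`a =Θ[atTop] b` is `a_n ≍ b_n`, for all large `n`. -/

/-- Ordinary-smooth scenario of order `β`, upper bound. -/
def OrdinarySmooth (s : ℕ → ℝ) (β : ℝ) : Prop :=
  0 ≤ β ∧ ∃ c > 0, ∀ l : ℕ, 1 ≤ l → s l ≤ c * (l : ℝ) ^ β

/-- Super-smooth scenario of order `β`, upper bound. -/
def SuperSmooth (s : ℕ → ℝ) (β γ α : ℝ) : Prop :=
  0 < β ∧ 0 < γ ∧ ∃ c > 0, ∀ l : ℕ, 1 ≤ l →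
    s l ≤ c * (l : ℝ) ^ α * Real.exp (γ * (l : ℝ) ^ β)

/-- Log-super-smooth scenario of order `β`, upper bound. -/
def LogSuperSmooth (s : ℕ → ℝ) (β γ α ξ : ℝ) : Prop :=
  0 < β ∧ 0 < γ ∧ ∃ c > 0, ∀ l : ℕ, 1 ≤ l →
    s l ≤ c * (l : ℝ) ^ α * Real.exp (γ * (l : ℝ) ^ β * (Real.log l - ξ))

/-- Truncation speed `T_n ≍ n^p` with `0 < p < 1/(2d-q)`. -/
def SpeedOrdinary (d : ℕ) (q : ℝ) (T : ℕ → ℝ) : Prop :=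
  ∃ p : ℝ, 0 < p ∧ p < 1 / (2 * d - q) ∧ T =Θ[atTop] fun n : ℕ => (n : ℝ) ^ p

/-- Truncation speed `T_n ≲ (log n)^{1/β}`. -/
def SpeedSuper (β : ℝ) (T : ℕ → ℝ) : Prop :=
  T =O[atTop] fun n : ℕ => Real.log n ^ (1 / β)

/-- Truncation speed `T_n ≲ (log n / log log n)^{1/β}`. -/
def SpeedLogSuper (β : ℝ) (T : ℕ → ℝ) : Prop :=
  T =O[atTop] fun n : ℕ => (Real.log n / Real.log (Real.log n)) ^ (1 / β)

/-- `M x n ≳ T_n^{2β+q}` for each `x`. -/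
def LowerOrdinary {S : Type} (M : S → ℕ → ℝ) (T : ℕ → ℝ) (β q : ℝ) : Prop :=
  ∀ x, (fun n => T n ^ (2 * β + q)) =O[atTop] M x

/-- `M x n ≳ T_n^{2α+q} exp(2γ (η T_n)^β)` for each `x` and each `0 < η < 1`. -/
def LowerSuper {S : Type} (M : S → ℕ → ℝ) (T : ℕ → ℝ) (β γ α q : ℝ) : Prop :=
  ∀ x, ∀ η : ℝ, 0 < η → η < 1 →
    (fun n => T n ^ (2 * α + q) * Real.exp (2 * γ * (η * T n) ^ β)) =O[atTop] M x

/-- `M x n ≳ T_n^{2α+q} exp(2γ (η T_n)^β (log T_n - ζ))` for each `x` and each `0 < η < 1`. -/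
def LowerLogSuper {S : Type} (M : S → ℕ → ℝ) (T : ℕ → ℝ) (β γ α q ζ : ℝ) : Prop :=
  ∀ x, ∀ η : ℝ, 0 < η → η < 1 →
    (fun n => T n ^ (2 * α + q) * Real.exp (2 * γ * (η * T n) ^ β * (Real.log (T n) - ζ)))
      =O[atTop] M x

end SphereDeconvolution

end

noncomputable section

namespace SphereDeconvolution

/-! ## A central limit theorem for bounded triangular arrays -/

/-! The centred, scaled estimator is a row sum of i.i.d. variables `g n (Z_i)` with `g n = Re
K_{T_n}(x, ·)`. Let b_n bound |g n| uniformly and let M_n = E[g n (Z)²]. If the means converge, M_n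
→ ∞ and b_n²/(n M_n) → 0, then the variance is eventually at least M_n/2, and a second-order
expansion of the characteristic function gives the normal limit (`tendstoInDistribution_row_sum`).

The means converge because independence of U and X turns E[conj B^l(Z)] into the rotational Fourier
matrix applied to the coefficients of f_X. The inverse matrix in the kernel cancels it, so
E[K_T(x,Z)] is a partial sum of the Fourier–Laplace series (`integral_kernelK`).

The bound b_n sums ‖(φ̃^l)⁻¹‖ N(d,l)/ν(S^d) over l ≤ T_n. It follows from Cauchy–Schwarz and the
constancy of ∑_q |B^l_q|², which rotation invariance and transitivity give (`sum_norm_sq_eq`,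
`norm_kernelK_le`). Since N(d,l) ≲ l^(d-1), b_n ≲ 1 + T_n^d H when H bounds the inverse norms for 1
≤ l ≤ T_n. In the ordinary-smooth case b_n²/(n M_n) ≲ T_n^(2d-q)/n. In the other two, with Y = T_n^β
or T_n^β log T_n, one has b_n ≤ exp((γ+ε)Y) and M_n ≥ exp((2γ-ε)Y) eventually; since Y = O(log n), a
small ε makes the ratio at most n^(-1/2).

One gap remains: for β = q = 0 the assumed lower bound on M_n does not force M_n → ∞. The case β = 0
is void, because a square integrable f_U cannot have bounded inverse Fourier matrices
(`not_bddAbove_invNorm`, by Bessel's inequality along orbits). -/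

theorem norm_charFun_sub_le {Ω : Type*} [MeasurableSpace Ω] {P : Measure Ω}
    [IsProbabilityMeasure P] {V : Ω → ℝ} (hV : Measurable V) {c t : ℝ} (hc : ∀ ω, |V ω| ≤ c)
    (h0 : ∫ ω, V ω ∂P = 0) (ht : |t| * c ≤ 1) :
    ‖charFun (P.map V) t - 1 + ((t ^ 2 / 2 * ∫ ω, V ω ^ 2 ∂P : ℝ) : ℂ)‖
      ≤ |t| ^ 3 * c * ∫ ω, V ω ^ 2 ∂P := by
  have hbd : ∀ {f : Ω → ℝ} {C : ℝ}, Measurable f → (∀ ω, |f ω| ≤ C) → Integrable f P :=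
    fun hf hC => Integrable.of_bound hf.aestronglyMeasurable _ (ae_of_all _ hC)
  have hV1 : Integrable V P := hbd hV hc
  have hV2 : Integrable (fun ω => V ω ^ 2) P := by
    refine hbd (C := c ^ 2) (hV.pow_const 2) fun ω => ?_
    rw [abs_pow]
    exact pow_le_pow_left₀ (abs_nonneg _) (hc ω) 2
  have hexp : Integrable (fun ω => Complex.exp (t * V ω * Complex.I)) P := by
    refine Integrable.of_bound (by fun_prop) 1 (ae_of_all _ fun ω => ?_)
    rw [← Complex.ofReal_mul, Complex.norm_exp_ofReal_mul_I]
  have hchar : charFun (P.map V) t - 1 + ((t ^ 2 / 2 * ∫ ω, V ω ^ 2 ∂P : ℝ) : ℂ)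
      = ∫ ω, (Complex.exp (t * V ω * Complex.I) - (1 + ((t * V ω : ℝ) : ℂ) * Complex.I
          - ((t ^ 2 / 2 * V ω ^ 2 : ℝ) : ℂ))) ∂P := by
    have h1 : Integrable (fun ω => ((t * V ω : ℝ) : ℂ) * Complex.I) P :=
      (hV1.const_mul t).ofReal.mul_const _
    have h01 : Integrable (fun ω => 1 + ((t * V ω : ℝ) : ℂ) * Complex.I) P :=
      (integrable_const _).add h1
    have h2 : Integrable (fun ω => ((t ^ 2 / 2 * V ω ^ 2 : ℝ) : ℂ)) P :=
      (hV2.const_mul _).ofReal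
    have h012 : Integrable (fun ω => 1 + ((t * V ω : ℝ) : ℂ) * Complex.I
        - ((t ^ 2 / 2 * V ω ^ 2 : ℝ) : ℂ)) P := h01.sub h2
    have e1 : ∫ ω, ((t * V ω : ℝ) : ℂ) * Complex.I ∂P = 0 := by
      rw [integral_mul_const, integral_complex_ofReal, integral_const_mul, h0]; simp
    have e2 : ∫ ω, ((t ^ 2 / 2 * V ω ^ 2 : ℝ) : ℂ) ∂P
        = ((t ^ 2 / 2 * ∫ ω, V ω ^ 2 ∂P : ℝ) : ℂ) := by
      rw [integral_complex_ofReal, integral_const_mul]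
    rw [integral_sub hexp h012, integral_sub h01 h2, integral_add (integrable_const _) h1, e1, e2,
      charFun_apply_real, integral_map hV.aemeasurable (by fun_prop)]
    simp
    ring
  rw [hchar, ← integral_const_mul]
  refine norm_integral_le_of_norm_le (hV2.const_mul _) (ae_of_all _ fun ω => ?_)
  set z : ℂ := t * V ω * Complex.I with hz
  have hzn : ‖z‖ = |t| * |V ω| := by simp [hz]
  have hz1 : ‖z‖ ≤ 1 := by
    rw [hzn]; exact (mul_le_mul_of_nonneg_left (hc ω) (abs_nonneg _)).trans ht
  -- The Taylor remainder is at most (2/9)‖z‖³ on the unit disc; the constant is rounded up to 1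
  -- below.
  have hb := Complex.exp_bound hz1 (n := 3) (by norm_num)
  have hs : ∑ m ∈ Finset.range 3, z ^ m / (m.factorial : ℂ)
      = 1 + ((t * V ω : ℝ) : ℂ) * Complex.I - ((t ^ 2 / 2 * V ω ^ 2 : ℝ) : ℂ) := by
    have hz2 : z ^ 2 = -((t * V ω : ℝ) : ℂ) ^ 2 := by
      rw [hz, mul_pow, Complex.I_sq]; push_cast; ring
    simp only [Finset.sum_range_succ, Finset.sum_range_zero, hz2]
    rw [hz]
    push_cast [Nat.factorial]
    ring
  rw [hs] at hb
  refine hb.trans ?_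
  rw [hzn]
  norm_num [Nat.factorial]
  -- Only one factor |V| is replaced by its bound, so the error stays proportional to the variance.
  have h3 : (|t| * |V ω|) ^ 3 ≤ |t| ^ 3 * c * V ω ^ 2 := by
    have : (|t| * |V ω|) ^ 3 = |t| ^ 3 * |V ω| * V ω ^ 2 := by
      rw [mul_pow, ← sq_abs (V ω)]; ring
    rw [this]
    gcongr
    exact hc ω
  have h4 : 0 ≤ (|t| * |V ω|) ^ 3 := by positivity
  linarith

/-- Central limit theorem for row sums `∑_{i<n} g n (Y i)` with `Y` i.i.d. and `g n` bounded,
under a Lyapunov type condition. -/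
theorem tendstoInDistribution_row_sum {Ω S : Type*} [MeasurableSpace Ω] [MeasurableSpace S]
    {P : Measure Ω} [IsProbabilityMeasure P] {Z : Ω → S} {Y : ℕ → Ω → S}
    (hindep : iIndepFun Y P) (hident : ∀ i, IdentDistrib (Y i) Z P P) (hZ : Measurable Z)
    {g : ℕ → S → ℝ} (hg : ∀ n, Measurable (g n)) {b : ℕ → ℝ} {m : ℝ}
    (hb : ∀ n z, |g n z| ≤ b n)
    (hm : Tendsto (fun n => ∫ ω, g n (Z ω) ∂P) atTop (𝓝 m))
    (hM : Tendsto (fun n => ∫ ω, g n (Z ω) ^ 2 ∂P) atTop atTop)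
    (hr : Tendsto (fun n : ℕ => b n ^ 2 / (n * ∫ ω, g n (Z ω) ^ 2 ∂P)) atTop (𝓝 0)) :
    TendstoInDistribution
      (fun (n : ℕ) ω => (√n * √(variance (fun ω => g n (Z ω)) P))⁻¹ *
        ∑ i ∈ Finset.range n, (g n (Y i ω) - ∫ ω, g n (Z ω) ∂P))
      atTop id (fun _ => P) (gaussianReal 0 1) where
  forall_aemeasurable n := by
    refine .const_mul (Finset.aemeasurable_fun_sum _ fun i _ => ?_) _
    exact ((hg n).comp_aemeasurable (hident i).aemeasurable_fst).sub_const _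
  tendsto := by
    refine ProbabilityMeasure.tendsto_iff_tendsto_charFun.2 fun t => ?_
    set μ : ℕ → ℝ := fun n => ∫ ω, g n (Z ω) ∂P with hμ
    set v : ℕ → ℝ := fun n => variance (fun ω => g n (Z ω)) P with hv
    set M : ℕ → ℝ := fun n => ∫ ω, g n (Z ω) ^ 2 ∂P with hMdef
    set V : ℕ → Ω → ℝ := fun n ω => g n (Z ω) - μ n with hVdef
    set s : ℕ → ℝ := fun n => (√n * √(v n))⁻¹ with hs
    have hVm : ∀ n, Measurable (V n) := fun n => ((hg n).comp hZ).sub_const _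
    have hgZ : ∀ n, Integrable (fun ω => g n (Z ω)) P := fun n =>
      Integrable.of_bound ((hg n).comp hZ).aestronglyMeasurable (b n) (ae_of_all _ fun ω => hb n _)
    have hg2 : ∀ n, MemLp (fun ω => g n (Z ω)) 2 P := fun n =>
      MemLp.of_bound ((hg n).comp hZ).aestronglyMeasurable (b n) (ae_of_all _ fun ω => hb n _)
    have hμb : ∀ n, |μ n| ≤ b n := fun n => by
      refine (norm_integral_le_of_norm_le_const (f := fun ω => g n (Z ω)) (C := b n)
        (ae_of_all P fun ω => hb n (Z ω))).trans ?_
      simp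
    have hVb : ∀ n ω, |V n ω| ≤ 2 * b n := fun n ω => by
      have := abs_sub (g n (Z ω)) (μ n)
      linarith [hb n (Z ω), hμb n]
    have hV0 : ∀ n, ∫ ω, V n ω ∂P = 0 := fun n => by
      rw [integral_sub (hgZ n) (integrable_const _)]; simp [hμ]
    have hVv : ∀ n, ∫ ω, V n ω ^ 2 ∂P = v n := fun n => by
      rw [hv]; simp only
      rw [variance_eq_integral (X := fun ω => g n (Z ω)) ((hg n).comp hZ).aemeasurable]
    have hvM : ∀ n, v n = M n - μ n ^ 2 := fun n => by
      rw [hv]; simp only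
      rw [variance_eq_sub (hg2 n)]; rfl
    -- The squared mean stays bounded while the second moment diverges, so centring costs at most
    -- half of it.
    have hvlow : ∀ᶠ n in atTop, M n / 2 ≤ v n := by
      have h1 : ∀ᶠ n in atTop, μ n ^ 2 ≤ m ^ 2 + 1 :=
        ((hm.pow 2).eventually (ge_mem_nhds (by linarith)))
      filter_upwards [h1, hM.eventually_ge_atTop (2 * (m ^ 2 + 1))] with n h1 h2
      rw [hvM]; linarith
    have hMpos : ∀ᶠ n in atTop, 0 < M n := hM.eventually_gt_atTop 0
    -- the normalized bound tends to zero
    have hbs : Tendsto (fun n => b n * s n) atTop (𝓝 0) := by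
      have hb0 : ∀ n, 0 ≤ b n := fun n => (abs_nonneg _).trans (hμb n)
      have hs0 : ∀ n, 0 ≤ s n := fun n => by positivity
      have hsq : Tendsto (fun n => (b n * s n) ^ 2) atTop (𝓝 0) := by
        refine squeeze_zero' (Eventually.of_forall fun n => sq_nonneg _) ?_
          (by simpa using hr.const_mul 2)
        filter_upwards [hvlow, hMpos, eventually_gt_atTop 0] with n h1 h2 h3
        have h3' : (0 : ℝ) < n := by exact_mod_cast h3
        have hvpos : 0 < v n := by linarith
        have : (b n * s n) ^ 2 = b n ^ 2 / (n * v n) := by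
          rw [hs]; simp only
          rw [mul_pow, inv_pow, mul_pow, Real.sq_sqrt h3'.le, Real.sq_sqrt hvpos.le]; rfl
        rw [this, ← mul_div_assoc, div_le_div_iff₀ (by positivity) (by positivity)]
        have : (n : ℝ) * M n ≤ 2 * (n * v n) := by nlinarith
        nlinarith [mul_le_mul_of_nonneg_left this (sq_nonneg (b n))]
      have := hsq.sqrt
      simp only [Real.sqrt_zero] at this
      refine this.congr fun n => Real.sqrt_sq (mul_nonneg (hb0 n) (hs0 n))
    have hchar : ∀ n : ℕ, charFun (P.map fun ω => s n *
        ∑ i ∈ Finset.range n, (g n (Y i ω) - μ n)) t = charFun (P.map (V n)) (s n * t) ^ n := by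
      intro n
      have hid : ∀ i, IdentDistrib (fun ω => g n (Y i ω) - μ n) (V n) P P := fun i =>
        (hident i).comp (u := fun z => g n z - μ n) ((hg n).sub_const _)
      have hind : iIndepFun (fun i ω => g n (Y i ω) - μ n) P :=
        hindep.comp (fun _ z => g n z - μ n) fun _ => (hg n).sub_const _
      have hm' := fun i => (hid i).aemeasurable_fst
      rw [charFun_map_mul_comp, (hind.restrict _).charFun_map_fun_finsetSum_eq_prod
        (fun _ _ => hm' _)]
      · simp [fun i => (hid i).map_eq]
      · exact Finset.aemeasurable_fun_sum _ fun _ _ => hm' _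
    -- The normalisation n s² v = 1 makes the quadratic term exactly t²/2 and reduces the cubic
    -- error to 2|t|³ b s, where 2b bounds the centred variable.
    have hlim : Tendsto (fun n : ℕ => (n : ℂ) * (charFun (P.map (V n)) (s n * t) - 1)) atTop
        (𝓝 (-(t ^ 2 / 2 : ℝ) : ℂ)) := by
      rw [tendsto_iff_norm_sub_tendsto_zero]
      have hup : Tendsto (fun n => 2 * |t| ^ 3 * (b n * s n)) atTop (𝓝 0) := by
        simpa using hbs.const_mul (2 * |t| ^ 3)
      have hsmall : ∀ᶠ n in atTop, 2 * |t| * (b n * s n) < 1 := by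
        have : Tendsto (fun n => 2 * |t| * (b n * s n)) atTop (𝓝 0) := by
          simpa using hbs.const_mul (2 * |t|)
        exact this.eventually (gt_mem_nhds one_pos)
      refine squeeze_zero' (Eventually.of_forall fun n => norm_nonneg _) ?_ hup
      filter_upwards [hvlow, hMpos, eventually_gt_atTop 0, hsmall] with n h1 h2 h3 h4
      have h3' : (0 : ℝ) < n := by exact_mod_cast h3
      have hvpos : 0 < v n := by linarith
      have hspos : 0 < s n := by rw [hs]; positivity
      have hsv : n * (s n ^ 2 * v n) = 1 := by
        rw [hs]; simp only
        rw [inv_pow, mul_pow, Real.sq_sqrt h3'.le, Real.sq_sqrt hvpos.le]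
        field_simp
      have habs : |s n * t| = s n * |t| := by rw [abs_mul, abs_of_pos hspos]
      have key := norm_charFun_sub_le (hVm n) (hVb n) (hV0 n) (t := s n * t)
        (by rw [habs]; linarith)
      rw [hVv, habs] at key
      have e : (n : ℂ) * (charFun (P.map (V n)) (s n * t) - 1) - (-(t ^ 2 / 2 : ℝ) : ℂ)
          = n * (charFun (P.map (V n)) (s n * t) - 1 + (((s n * t) ^ 2 / 2 * v n : ℝ) : ℂ)) := by
        have : (t ^ 2 / 2 : ℝ) = n * ((s n * t) ^ 2 / 2 * v n) := by
          linear_combination (-(t ^ 2 / 2)) * hsv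
        rw [this]; push_cast; ring
      rw [e, norm_mul, Complex.norm_natCast]
      refine (mul_le_mul_of_nonneg_left key h3'.le).trans (le_of_eq ?_)
      linear_combination (2 * |t| ^ 3 * b n * s n) * hsv
    have hpow := Complex.tendsto_one_add_pow_exp_of_tendsto hlim
    have hG : charFun ((gaussianReal 0 1).map id) t = Complex.exp (-(t ^ 2 / 2 : ℝ) : ℂ) := by
      rw [Measure.map_id, charFun_gaussianReal]
      congr 1
      push_cast
      simp
    change Tendsto (fun n => charFun (P.map fun ω => s n *
        ∑ i ∈ Finset.range n, (g n (Y i ω) - μ n)) t) atTop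
        (𝓝 (charFun ((gaussianReal 0 1).map id) t))
    rw [hG]
    refine hpow.congr fun n => ?_
    rw [hchar n]
    simp

/-! ## Rotations of the sphere -/

theorem rot_apply {d : ℕ} (u : SO d) (x : Sph d) (i : Fin (d + 1)) :
    (rot u x).1 i = ∑ j, u.1 i j * x.1 j := rfl

theorem rot_mul {d : ℕ} (u v : SO d) (x : Sph d) : rot (u * v) x = rot u (rot v x) := by
  refine Subtype.ext ?_
  simp [rot, Matrix.mulVec_mulVec]

theorem rot_one {d : ℕ} (x : Sph d) : rot 1 x = x := by
  refine Subtype.ext ?_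
  simp [rot]

theorem continuous_rot {d : ℕ} : Continuous fun p : SO d × Sph d => rot p.1 p.2 := by
  refine Continuous.subtype_mk ?_ _
  refine (PiLp.continuous_toLp 2 _).comp ?_
  exact (continuous_subtype_val.comp continuous_fst).matrix_mulVec
    ((PiLp.continuous_ofLp 2 _).comp (continuous_subtype_val.comp continuous_snd))

theorem continuous_rot_left {d : ℕ} (x : Sph d) : Continuous fun u : SO d => rot u x :=
  continuous_rot.comp (by fun_prop : Continuous fun u : SO d => (u, x))

theorem continuous_rot_right {d : ℕ} (u : SO d) : Continuous (rot u) :=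
  continuous_rot.comp (by fun_prop : Continuous fun x : Sph d => (u, x))

/-- A rotation as a linear isometry of the ambient space. -/
def rotIsometry {d : ℕ} (u : SO d) :
    EuclideanSpace ℝ (Fin (d + 1)) ≃ₗᵢ[ℝ] EuclideanSpace ℝ (Fin (d + 1)) :=
  LinearIsometry.toLinearIsometryEquiv
    { toLinearMap := Matrix.toEuclideanLin u.1
      norm_map' := fun x => by
        have key : (u.1.mulVec (WithLp.ofLp x)) ⬝ᵥ (u.1.mulVec (WithLp.ofLp x))
            = (WithLp.ofLp x) ⬝ᵥ (WithLp.ofLp x) := by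
          rw [Matrix.dotProduct_mulVec, Matrix.vecMul_mulVec, SO.transpose_mul_self,
            Matrix.vecMul_one]
        have : ‖Matrix.toEuclideanLin u.1 x‖ ^ 2 = ‖x‖ ^ 2 := by
          rw [EuclideanSpace.real_norm_sq_eq, EuclideanSpace.real_norm_sq_eq]
          simp only [dotProduct, ← sq] at key
          exact key
        exact (pow_left_inj₀ (norm_nonneg _) (norm_nonneg _) two_ne_zero).1 this } rfl

theorem rotIsometry_coe {d : ℕ} (u : SO d) (x : Sph d) : rotIsometry u x.1 = (rot u x).1 := rfl

-- Surface measure is Lebesgue measure of the cone over a set, and the rotation extends to a linear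
-- isometry that maps cones to cones.
open scoped Pointwise in
theorem measurePreserving_rot {d : ℕ} (u : SO d) : MeasurePreserving (rot u) (nu d) (nu d) where
  measurable := (continuous_rot_right u).measurable
  map_eq := by
    ext s hs
    have hm := (continuous_rot_right u).measurable
    rw [Measure.map_apply hm hs, nu, Measure.toSphere_apply' _ (hm hs),
      Measure.toSphere_apply' _ hs]
    congr 1
    have hset : (Set.Ioo (0 : ℝ) 1 • (Subtype.val '' (rot u ⁻¹' s)) :
        Set (EuclideanSpace ℝ (Fin (d + 1))))
        = rotIsometry u ⁻¹' (Set.Ioo (0 : ℝ) 1 • (Subtype.val '' s)) := by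
      ext y
      simp only [Set.mem_preimage, Set.mem_smul, Set.mem_image]
      constructor
      · rintro ⟨t, ht, _, ⟨x, hx, rfl⟩, rfl⟩
        exact ⟨t, ht, _, ⟨rot u x, hx, rfl⟩, by rw [map_smul, rotIsometry_coe]⟩
      · rintro ⟨t, ht, _, ⟨x, hx, rfl⟩, h⟩
        have hx' : rot u (rot u⁻¹ x) = x := by rw [← rot_mul, mul_inv_cancel, rot_one]
        refine ⟨t, ht, _, ⟨rot u⁻¹ x, ?_, rfl⟩, ?_⟩
        · exact hx'.symm ▸ hx
        · apply (rotIsometry u).injective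
          rw [map_smul, rotIsometry_coe, hx', h]
    rw [hset]
    exact (rotIsometry u).measurePreserving.measure_preimage_equiv
      (f := (rotIsometry u).toHomeomorph.toMeasurableEquiv) _

theorem integral_comp_rot {d : ℕ} (u : SO d) (f : Sph d → ℂ) :
    ∫ x, f (rot u x) ∂(nu d) = ∫ x, f x ∂(nu d) := by
  have hemb : MeasurableEmbedding (rot u) :=
    (continuous_rot_right u).measurableEmbedding fun x y h => by
      have := congrArg (rot u⁻¹) h
      simpa [← rot_mul, rot_one] using this
  exact (measurePreserving_rot u).integral_comp hemb f

/-! ### Finiteness and invariance of the two measures -/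

instance SO.instSecondCountableTopology (d : ℕ) : SecondCountableTopology (SO d) :=
  have : SecondCountableTopology (Matrix (Fin (d + 1)) (Fin (d + 1)) ℝ) :=
    inferInstanceAs (SecondCountableTopology (Fin (d + 1) → Fin (d + 1) → ℝ))
  TopologicalSpace.Subtype.secondCountableTopology _

instance nu.instIsFiniteMeasure (d : ℕ) : IsFiniteMeasure (nu d) := by
  unfold nu; infer_instance

theorem nu_univ_pos (d : ℕ) : 0 < (nu d).real Set.univ := by
  have : nu d ≠ 0 := Measure.toSphere_ne_zero _
  rw [Measure.real, ENNReal.toReal_pos_iff]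
  exact ⟨Measure.measure_univ_pos.2 this, measure_lt_top _ _⟩

instance muSO.instIsHaarMeasure (d : ℕ) : (muSO d).IsHaarMeasure := by
  unfold muSO; infer_instance

instance muSO.instIsProbabilityMeasure (d : ℕ) : IsProbabilityMeasure (muSO d) :=
  ⟨by
    have := Measure.haarMeasure_self (K₀ := (⊤ : TopologicalSpace.PositiveCompacts (SO d)))
    simpa [muSO] using this⟩

instance muSO.instIsMulRightInvariant (d : ℕ) : (muSO d).IsMulRightInvariant where
  map_mul_right_eq_self g := by
    -- A right translate of Haar measure is again a left Haar probability measure, so uniqueness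
    -- identifies the two: compact groups are unimodular.
    have h1 : ((muSO d).map (· * g)).IsHaarMeasure := inferInstance
    have h2 : IsProbabilityMeasure ((muSO d).map (· * g)) :=
      Measure.isProbabilityMeasure_map (by fun_prop)
    exact Measure.isHaarMeasure_eq_of_isProbabilityMeasure _ _

/-! ### Transitivity -/

/-- The Householder matrix `1 - 2 v vᵀ / |v|²`. -/
def householder {d : ℕ} (v : Fin (d + 1) → ℝ) : Matrix (Fin (d + 1)) (Fin (d + 1)) ℝ :=
  1 - (2 / (v ⬝ᵥ v)) • Matrix.vecMulVec v v

theorem householder_transpose {d : ℕ} (v : Fin (d + 1) → ℝ) :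
    (householder v).transpose = householder v := by
  simp [householder, Matrix.transpose_vecMulVec]

theorem householder_mulVec {d : ℕ} (v w : Fin (d + 1) → ℝ) :
    (householder v).mulVec w = w - (2 * (v ⬝ᵥ w) / (v ⬝ᵥ v)) • v := by
  rw [householder, Matrix.sub_mulVec, Matrix.one_mulVec, Matrix.smul_mulVec,
    Matrix.vecMulVec_mulVec]
  congr 1
  ext i
  simp
  ring

theorem householder_mul_self {d : ℕ} {v : Fin (d + 1) → ℝ} (hv : v ⬝ᵥ v ≠ 0) :
    householder v * householder v = 1 := by
  simp only [householder, sub_mul, mul_sub, one_mul, mul_one, Matrix.smul_mul, Matrix.mul_smul,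
    Matrix.vecMulVec_mul_vecMulVec]
  ext i j
  simp [Matrix.vecMulVec_apply]
  field_simp
  ring

theorem det_householder {d : ℕ} {v : Fin (d + 1) → ℝ} (hv : v ⬝ᵥ v ≠ 0) :
    (householder v).det = -1 := by
  have : householder v = 1 - Matrix.vecMulVec ((2 / (v ⬝ᵥ v)) • v) v := by
    rw [householder, Matrix.smul_vecMulVec]
  rw [this, Matrix.vecMulVec_eq Unit, Matrix.det_one_sub_mul_comm, Matrix.det_unique]
  have h : (Matrix.replicateRow Unit v * Matrix.replicateCol Unit ((2 / (v ⬝ᵥ v)) • v))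
      default default = v ⬝ᵥ ((2 / (v ⬝ᵥ v)) • v) := rfl
  rw [Matrix.sub_apply, h, dotProduct_smul, smul_eq_mul, div_mul_cancel₀ _ hv, Matrix.one_apply_eq]
  norm_num

theorem householder_mul_mem {d : ℕ} {v w : Fin (d + 1) → ℝ} (hw : w ⬝ᵥ w ≠ 0)
    (hv : v ⬝ᵥ v ≠ 0) :
    householder w * householder v ∈ Matrix.specialOrthogonalGroup (Fin (d + 1)) ℝ := by
  rw [Matrix.mem_specialOrthogonalGroup_iff, Matrix.mem_orthogonalGroup_iff']
  refine ⟨?_, by rw [Matrix.det_mul, det_householder hv, det_householder hw]; norm_num⟩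
  change (householder w * householder v).transpose * _ = 1
  rw [Matrix.transpose_mul, householder_transpose, householder_transpose, Matrix.mul_assoc,
    ← Matrix.mul_assoc (householder w), householder_mul_self hw, Matrix.one_mul,
    householder_mul_self hv]

/-- The reflection along x - y sends x to y but has determinant -1. Composing it with a reflection
along some w ⊥ y, which fixes y, corrects the determinant. -/
theorem exists_rot_eq {d : ℕ} (hd : 1 ≤ d) (x y : Sph d) : ∃ u : SO d, rot u x = y := by
  by_cases hxy : x = y
  · exact ⟨1, by rw [rot_one, hxy]⟩
  set a : Fin (d + 1) → ℝ := WithLp.ofLp x.1 with ha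
  set b : Fin (d + 1) → ℝ := WithLp.ofLp y.1 with hb
  have hn : ∀ z : Sph d, (WithLp.ofLp z.1) ⬝ᵥ (WithLp.ofLp z.1) = 1 := fun z => by
    have hz : ‖z.1‖ ^ 2 = 1 := by simp
    rw [EuclideanSpace.real_norm_sq_eq] at hz
    simpa [dotProduct, ← sq] using hz
  have haa : a ⬝ᵥ a = 1 := hn x
  have hbb : b ⬝ᵥ b = 1 := hn y
  set v := a - b with hv
  have hv0 : v ≠ 0 := fun h => hxy <| Subtype.ext <| (WithLp.ofLp_injective 2) (sub_eq_zero.1 h)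
  have hvv : v ⬝ᵥ v ≠ 0 := fun h => hv0 (dotProduct_self_eq_zero.1 h)
  -- A nonzero vector orthogonal to y requires a second coordinate, hence d ≥ 1.
  obtain ⟨w, hw0, hw⟩ : ∃ w : Fin (d + 1) → ℝ, w ≠ 0 ∧ w ⬝ᵥ b = 0 := by
    have h01 : (0 : Fin (d + 1)) ≠ ⟨1, by omega⟩ := by simp [Fin.ext_iff]
    by_cases h : b 0 = 0
    · exact ⟨Pi.single 0 1, by simp, by simp [h]⟩
    · refine ⟨Pi.single 0 (-b ⟨1, by omega⟩) + Pi.single ⟨1, by omega⟩ (b 0), fun hw => h ?_, ?_⟩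
      · have := congrFun hw ⟨1, by omega⟩
        simpa [h01.symm] using this
      · rw [add_dotProduct, single_dotProduct, single_dotProduct]; ring
  have hww : w ⬝ᵥ w ≠ 0 := fun h => hw0 (dotProduct_self_eq_zero.1 h)
  have hmem := householder_mul_mem hww hvv
  refine ⟨⟨_, hmem⟩, Subtype.ext ?_⟩
  apply WithLp.ofLp_injective 2
  change (householder w * householder v).mulVec a = b
  have h1 : (householder v).mulVec a = b := by
    rw [householder_mulVec]
    have : 2 * (v ⬝ᵥ a) / (v ⬝ᵥ v) = 1 := by
      rw [div_eq_one_iff_eq hvv]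
      simp only [hv, sub_dotProduct, dotProduct_sub, haa, hbb, dotProduct_comm b a]
      ring
    rw [this, one_smul, hv, sub_sub_cancel]
  rw [← Matrix.mulVec_mulVec, h1, householder_mulVec, hw]
  simp

/-! ## Rotation invariance of the spherical harmonics -/

/-- The linear substitution `X ↦ u X`. -/
def rotPoly {d : ℕ} (u : SO d) :
    MvPolynomial (Fin (d + 1)) ℂ →ₐ[ℂ] MvPolynomial (Fin (d + 1)) ℂ :=
  MvPolynomial.aeval fun i => ∑ j, MvPolynomial.C ((u.1 i j : ℝ) : ℂ) * MvPolynomial.X j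

theorem rotPoly_X {d : ℕ} (u : SO d) (i : Fin (d + 1)) :
    rotPoly u (MvPolynomial.X i)
      = ∑ j, MvPolynomial.C ((u.1 i j : ℝ) : ℂ) * MvPolynomial.X j := by
  simp [rotPoly]

theorem pderiv_rotPoly {d : ℕ} (u : SO d) (k : Fin (d + 1)) (p : MvPolynomial (Fin (d + 1)) ℂ) :
    MvPolynomial.pderiv k (rotPoly u p)
      = ∑ i, MvPolynomial.C ((u.1 i k : ℝ) : ℂ) * rotPoly u (MvPolynomial.pderiv i p) := by
  induction p using MvPolynomial.induction_on with
  | C a => simp [rotPoly, MvPolynomial.algebraMap_eq]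
  | add p q hp hq => simp [hp, hq, mul_add, Finset.sum_add_distrib]
  | mul_X p j hp =>
    have hX : MvPolynomial.pderiv k (rotPoly u (MvPolynomial.X j))
        = MvPolynomial.C ((u.1 j k : ℝ) : ℂ) := by
      rw [rotPoly_X, map_sum]
      simp only [MvPolynomial.pderiv_C_mul, MvPolynomial.pderiv_X, Pi.single_apply]
      simp
    simp only [map_mul, map_add, MvPolynomial.pderiv_mul, hp, hX, mul_add,
      Finset.sum_add_distrib, MvPolynomial.pderiv_X, Pi.single_apply]
    congr 1
    · rw [Finset.sum_mul]
      exact Finset.sum_congr rfl fun i _ => by ring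
    · rw [Finset.sum_eq_single j]
      · simp [mul_comm]
      · intro i _ hi
        simp [hi.symm]
      · simp

theorem laplacian_apply {d : ℕ} (p : MvPolynomial (Fin (d + 1)) ℂ) :
    laplacian d p = ∑ i, MvPolynomial.pderiv i (MvPolynomial.pderiv i p) := by
  simp [laplacian]

/-- By the chain rule the second derivatives are contracted with u uᵀ = 1, which leaves only the
diagonal terms. -/
theorem laplacian_rotPoly {d : ℕ} (u : SO d) (p : MvPolynomial (Fin (d + 1)) ℂ) :
    laplacian d (rotPoly u p) = rotPoly u (laplacian d p) := by
  have horth : ∀ i j, ∑ k, u.1 i k * u.1 j k = if i = j then 1 else 0 := fun i j => by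
    have : u.1 * u.1.transpose = 1 :=
      (Matrix.mem_orthogonalGroup_iff _ _).1 (Matrix.mem_specialOrthogonalGroup_iff.1 u.2).1
    have := congrFun (congrFun this i) j
    simpa [Matrix.mul_apply, Matrix.one_apply] using this
  simp only [laplacian_apply, pderiv_rotPoly, map_sum, MvPolynomial.pderiv_C_mul, Finset.mul_sum]
  calc _ = ∑ i, ∑ j, MvPolynomial.C (((∑ k, u.1 i k * u.1 j k : ℝ)) : ℂ) *
        rotPoly u (MvPolynomial.pderiv j (MvPolynomial.pderiv i p)) := by
        rw [Finset.sum_comm]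
        refine Finset.sum_congr rfl fun i _ => ?_
        rw [Finset.sum_comm]
        refine Finset.sum_congr rfl fun j _ => ?_
        push_cast
        rw [map_sum, Finset.sum_mul]
        refine Finset.sum_congr rfl fun k _ => ?_
        rw [map_mul, mul_assoc]
    _ = _ := by
        refine Finset.sum_congr rfl fun i _ => ?_
        rw [Finset.sum_eq_single i]
        · simp [horth]
        · intro j _ hj
          simp [horth, hj.symm]
        · simp

theorem restrictToSphere_rotPoly {d : ℕ} (u : SO d) (p : MvPolynomial (Fin (d + 1)) ℂ)
    (x : Sph d) : restrictToSphere d (rotPoly u p) x = restrictToSphere d p (rot u x) := by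
  have : (MvPolynomial.aeval fun i => ((x.1 i : ℝ) : ℂ)).comp (rotPoly u)
      = MvPolynomial.aeval fun i => (((rot u x).1 i : ℝ) : ℂ) := by
    refine MvPolynomial.algHom_ext fun i => ?_
    rw [AlgHom.comp_apply, rotPoly_X, MvPolynomial.aeval_X, rot_apply]
    simp
  exact DFunLike.congr_fun this p

theorem comp_rot_mem_harmonicSpace {d l : ℕ} (u : SO d) {f : Sph d → ℂ}
    (hf : f ∈ harmonicSpace d l) : (fun x => f (rot u x)) ∈ harmonicSpace d l := by
  obtain ⟨p, ⟨hp1, hp2⟩, rfl⟩ := hf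
  refine ⟨rotPoly u p, ⟨?_, ?_⟩, funext fun x => restrictToSphere_rotPoly u p x⟩
  · have h : (rotPoly u p).IsHomogeneous (1 * l) := by
      refine MvPolynomial.IsHomogeneous.aeval hp1 _ fun i => ?_
      refine MvPolynomial.IsHomogeneous.sum _ _ _ fun j _ => ?_
      simpa using (MvPolynomial.isHomogeneous_C _ _).mul (MvPolynomial.isHomogeneous_X ℂ j)
    rw [one_mul] at h
    exact h
  · have hp2' : laplacian d p = 0 := hp2
    change laplacian d (rotPoly u p) = 0
    rw [laplacian_rotPoly, hp2', map_zero]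

theorem continuous_of_mem_harmonicSpace {d l : ℕ} {f : Sph d → ℂ}
    (hf : f ∈ harmonicSpace d l) : Continuous f := by
  obtain ⟨p, -, rfl⟩ := hf
  change Continuous fun x : Sph d => MvPolynomial.aeval (fun i => ((x.1 i : ℝ) : ℂ)) p
  simp only [MvPolynomial.aeval_def]
  refine (MvPolynomial.continuous_eval p).comp
    (f := fun x : Sph d => fun i => ((x.1 i : ℝ) : ℂ)) ?_ |>.congr fun x => rfl
  refine continuous_pi fun i => Complex.continuous_ofReal.comp ?_
  exact (EuclideanSpace.proj (𝕜 := ℝ) i).continuous.comp continuous_subtype_val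

/-- The spherical harmonic `(x₀ + i x₁)^l`. -/
def planeHarmonic {d : ℕ} (hd : 1 ≤ d) (l : ℕ) (x : Sph d) : ℂ :=
  (((x.1 0 : ℝ) : ℂ) + Complex.I * ((x.1 ⟨1, by omega⟩ : ℝ) : ℂ)) ^ l

theorem planeHarmonic_mem {d : ℕ} (hd : 1 ≤ d) (l : ℕ) :
    planeHarmonic hd l ∈ harmonicSpace d l := by
  have h10 : (⟨1, by omega⟩ : Fin (d + 1)) ≠ 0 := by simp [Fin.ext_iff]
  set j : Fin (d + 1) := ⟨1, by omega⟩ with hj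
  set p : MvPolynomial (Fin (d + 1)) ℂ :=
    MvPolynomial.X 0 + MvPolynomial.C Complex.I * MvPolynomial.X j with hp
  have hd1 : ∀ i, MvPolynomial.pderiv i p
      = MvPolynomial.C (if i = 0 then 1 else if i = j then Complex.I else 0) := fun i => by
    rw [hp, map_add, MvPolynomial.pderiv_C_mul, MvPolynomial.pderiv_X, MvPolynomial.pderiv_X,
      Pi.single_apply, Pi.single_apply]
    by_cases h0 : i = 0
    · subst h0
      simp [h10]
    · by_cases h1 : i = j
      · subst h1
        simp [h10, h10.symm]
      · simp [h0, h1, Ne.symm h0, Ne.symm h1]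
  refine ⟨p ^ l, ⟨?_, ?_⟩, ?_⟩
  · have : p.IsHomogeneous 1 := (MvPolynomial.isHomogeneous_X ℂ _).add
      (by simpa using (MvPolynomial.isHomogeneous_C _ _).mul (MvPolynomial.isHomogeneous_X ℂ j))
    have := this.pow l
    rw [one_mul] at this
    exact this
  · change laplacian d (p ^ l) = 0
    rw [laplacian_apply]
    have h2 : ∀ i, MvPolynomial.pderiv i (MvPolynomial.pderiv i (p ^ l))
        = (l : MvPolynomial (Fin (d + 1)) ℂ) *
          (((l - 1 : ℕ) : MvPolynomial (Fin (d + 1)) ℂ) * p ^ (l - 1 - 1)) *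
          MvPolynomial.C ((if i = 0 then 1 else if i = j then Complex.I else 0) ^ 2) := fun i => by
      rw [MvPolynomial.pderiv_pow, hd1, mul_comm _ (MvPolynomial.C _), MvPolynomial.pderiv_C_mul,
        ← map_natCast MvPolynomial.C l, MvPolynomial.pderiv_C_mul, MvPolynomial.pderiv_pow, hd1,
        map_pow]
      ring
    simp only [h2]
    rw [← Finset.mul_sum, ← map_sum]
    -- The gradient of x₀ + i x₁ is isotropic: 1 + i² = 0. This makes every power harmonic.
    have : ∑ i : Fin (d + 1), (if i = 0 then 1 else if i = j then Complex.I else 0) ^ 2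
        = (0 : ℂ) := by
      rw [← Finset.add_sum_erase _ _ (Finset.mem_univ 0), ← Finset.add_sum_erase _ _
        (show j ∈ Finset.univ.erase 0 by simp [h10]), Finset.sum_eq_zero]
      · simp [h10]
      · intro i hi
        simp only [Finset.mem_erase] at hi
        simp [hi.1, hi.2.1]
    rw [this]
    simp
  · funext x
    change MvPolynomial.aeval (fun i => ((x.1 i : ℝ) : ℂ)) (p ^ l) = _
    simp [hp, planeHarmonic, hj]

/-! ## Orthonormal bases of spherical harmonics -/

theorem integrable_nu_of_continuous {d : ℕ} {E : Type*} [NormedAddCommGroup E] {f : Sph d → E}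
    (hf : Continuous f) : Integrable f (nu d) :=
  hf.integrable_of_hasCompactSupport (HasCompactSupport.of_compactSpace f)

theorem IsHarmonicONB.mem {d l : ℕ} {b : Fin (dimHarm d l) → Sph d → ℂ}
    (h : IsHarmonicONB d l b) (q : Fin (dimHarm d l)) : b q ∈ harmonicSpace d l :=
  h.span_eq ▸ Submodule.subset_span ⟨q, rfl⟩

theorem IsHarmonicONB.continuous {d l : ℕ} {b : Fin (dimHarm d l) → Sph d → ℂ}
    (h : IsHarmonicONB d l b) (q : Fin (dimHarm d l)) : Continuous (b q) :=
  continuous_of_mem_harmonicSpace (h.mem q)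

theorem IsHarmonicONB.eq_sum {d l : ℕ} {b : Fin (dimHarm d l) → Sph d → ℂ}
    (h : IsHarmonicONB d l b) {f : Sph d → ℂ} (hf : f ∈ harmonicSpace d l) (x : Sph d) :
    f x = ∑ r, innerL2 d f (b r) * b r x := by
  rw [← h.span_eq, Submodule.mem_span_range_iff_exists_fun] at hf
  obtain ⟨c, rfl⟩ := hf
  have hc : ∀ r, innerL2 d (∑ i, c i • b i) (b r) = c r := fun r => by
    have h1 : innerL2 d (∑ i, c i • b i) (b r) = ∑ i, c i * innerL2 d (b i) (b r) := by
      simp only [innerL2, Finset.sum_apply, Pi.smul_apply, smul_eq_mul, Finset.sum_mul]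
      rw [integral_finsetSum]
      · refine Finset.sum_congr rfl fun i _ => ?_
        rw [← integral_const_mul]
        exact integral_congr_ae (ae_of_all _ fun x => by ring)
      · intro i _
        have := h.continuous
        exact integrable_nu_of_continuous (by fun_prop)
    rw [h1]
    simp [h.orthonormal]
  simp [hc]

/-- The harmonics of order l are stable under rotation, so the rotated basis expands in the basis
itself; after conjugation the coefficients are the entries of D^l(u). -/
theorem IsHarmonicONB.conj_comp_rot {d : ℕ} {B : (l : ℕ) → Fin (dimHarm d l) → Sph d → ℂ}
    (hB : ∀ l, IsHarmonicONB d l (B l)) (l : ℕ) (q : Fin (dimHarm d l)) (u : SO d) (x : Sph d) :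
    conj (B l q (rot u x)) = ∑ r, rotCoeff d B l q r u * conj (B l r x) := by
  rw [(hB l).eq_sum (comp_rot_mem_harmonicSpace u ((hB l).mem q)) x, map_sum]
  refine Finset.sum_congr rfl fun r _ => ?_
  rw [map_mul, innerL2, ← integral_conj, rotCoeff]
  simp

/-- The matrix `D^l(u)`. -/
def rotMatrix (d : ℕ) (B : (l : ℕ) → Fin (dimHarm d l) → Sph d → ℂ) (l : ℕ) (u : SO d) :
    Matrix (Fin (dimHarm d l)) (Fin (dimHarm d l)) ℂ :=
  Matrix.of fun q r => rotCoeff d B l q r u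

/-- Unitarity of D^l(u): rotation preserves ν, so the rotated basis is still orthonormal. -/
theorem rotMatrix_mul_conjTranspose {d : ℕ} {B : (l : ℕ) → Fin (dimHarm d l) → Sph d → ℂ}
    (hB : ∀ l, IsHarmonicONB d l (B l)) (l : ℕ) (u : SO d) :
    rotMatrix d B l u * (rotMatrix d B l u).conjTranspose = 1 := by
  ext q q'
  have hcont := fun q => (hB l).continuous q
  have hrot := continuous_rot_right u
  have h1 := (hB l).orthonormal q' q
  rw [innerL2, ← integral_comp_rot u] at h1
  simp only [IsHarmonicONB.conj_comp_rot hB l q, Finset.mul_sum] at h1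
  rw [integral_finsetSum] at h1
  · rw [Matrix.mul_apply, Matrix.one_apply]
    simp only [eq_comm (a := q') (b := q)] at h1
    rw [← h1]
    refine Finset.sum_congr rfl fun r _ => ?_
    rw [Matrix.conjTranspose_apply]
    simp only [rotMatrix, Matrix.of_apply]
    have : ∫ x, B l q' (rot u x) * (rotCoeff d B l q r u * conj (B l r x)) ∂(nu d)
        = rotCoeff d B l q r u * ∫ x, B l q' (rot u x) * conj (B l r x) ∂(nu d) := by
      rw [← integral_const_mul]
      exact integral_congr_ae (ae_of_all _ fun x => by ring)
    rw [this]
    congr 1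
    rw [rotCoeff]
    change conj _ = _
    rw [← integral_conj]
    simp
  · intro r _
    refine integrable_nu_of_continuous ?_
    have := hcont
    fun_prop

theorem sum_norm_sq_comp_rot {d : ℕ} {B : (l : ℕ) → Fin (dimHarm d l) → Sph d → ℂ}
    (hB : ∀ l, IsHarmonicONB d l (B l)) (l : ℕ) (u : SO d) (x : Sph d) :
    ∑ q, ‖B l q (rot u x)‖ ^ 2 = ∑ q, ‖B l q x‖ ^ 2 := by
  set D := rotMatrix d B l u
  set w : Sph d → Fin (dimHarm d l) → ℂ := fun y q => conj (B l q y) with hw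
  -- For a square matrix a right inverse is a left inverse; it is this side that preserves the norm
  -- of D w.
  have hD : D.conjTranspose * D = 1 :=
    mul_eq_one_comm.1 (rotMatrix_mul_conjTranspose hB l u)
  have hrot : w (rot u x) = D.mulVec (w x) := by
    funext q
    rw [hw]
    simp only [IsHarmonicONB.conj_comp_rot hB]
    rfl
  have hn : ∀ y, ((∑ q, ‖B l q y‖ ^ 2 : ℝ) : ℂ) = star (w y) ⬝ᵥ w y := fun y => by
    simp only [dotProduct, hw, Pi.star_apply, RCLike.star_def, Complex.conj_conj, Complex.mul_conj,
      Complex.normSq_eq_norm_sq]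
    push_cast
    rfl
  have : ((∑ q, ‖B l q (rot u x)‖ ^ 2 : ℝ) : ℂ) = ((∑ q, ‖B l q x‖ ^ 2 : ℝ) : ℂ) := by
    rw [hn, hn, hrot, Matrix.star_mulVec, Matrix.dotProduct_mulVec, Matrix.vecMul_vecMul, hD,
      Matrix.vecMul_one]
  exact_mod_cast this

/-- The sum of squares of an orthonormal basis of spherical harmonics is constant. -/
theorem sum_norm_sq_eq {d : ℕ} (hd : 1 ≤ d) {B : (l : ℕ) → Fin (dimHarm d l) → Sph d → ℂ}
    (hB : ∀ l, IsHarmonicONB d l (B l)) (l : ℕ) (x : Sph d) :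
    ∑ q, ‖B l q x‖ ^ 2 = dimHarm d l / (nu d).real Set.univ := by
  have hcont := fun q => (hB l).continuous q
  -- Invariance under a transitive action makes the sum constant; its value is then read off from
  -- its integral, the number of unit vectors in the basis.
  have hconst : ∀ y, ∑ q, ‖B l q y‖ ^ 2 = ∑ q, ‖B l q x‖ ^ 2 := fun y => by
    obtain ⟨u, rfl⟩ := exists_rot_eq hd x y
    exact sum_norm_sq_comp_rot hB l u x
  have hint : ∫ y, ∑ q, ‖B l q y‖ ^ 2 ∂(nu d) = dimHarm d l := by
    rw [integral_finsetSum _ fun q _ =>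
      integrable_nu_of_continuous (f := fun y => ‖B l q y‖ ^ 2) ((hcont q).norm.pow 2)]
    have : ∀ q, ∫ y, ‖B l q y‖ ^ 2 ∂(nu d) = 1 := fun q => by
      have h1 := (hB l).orthonormal q q
      rw [if_pos rfl, innerL2] at h1
      have h2 : ∫ y, ((‖B l q y‖ ^ 2 : ℝ) : ℂ) ∂(nu d) = 1 := by
        rw [← h1]
        refine integral_congr_ae (ae_of_all _ fun y => ?_)
        simp only [Complex.mul_conj, Complex.normSq_eq_norm_sq]
      rw [integral_complex_ofReal] at h2
      exact_mod_cast h2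
    simp [this]
  simp only [hconst, integral_const, smul_eq_mul] at hint
  rw [← hint]
  field_simp [(nu_univ_pos d).ne']

/-! ### Uniform bound and continuity of the kernel -/

theorem opNorm_nonneg {N : ℕ} (A : Matrix (Fin N) (Fin N) ℂ) : 0 ≤ opNorm A := norm_nonneg _

/-- The double sum is the inner product of conj w with A v, so Cauchy–Schwarz applies. -/
theorem norm_sum_mulVec_mul_le {N : ℕ} (A : Matrix (Fin N) (Fin N) ℂ) (v w : Fin N → ℂ) :
    ‖∑ q, (∑ r, A q r * v r) * w q‖ ≤ opNorm A * √(∑ r, ‖v r‖ ^ 2) * √(∑ q, ‖w q‖ ^ 2) := by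
  have h1 := (Matrix.toEuclideanCLM (n := Fin N) (𝕜 := ℂ) A).le_opNorm (WithLp.toLp 2 v)
  have h2 := norm_inner_le_norm (𝕜 := ℂ) (WithLp.toLp 2 fun q => conj (w q))
    (Matrix.toEuclideanCLM (n := Fin N) (𝕜 := ℂ) A (WithLp.toLp 2 v))
  have hn : ∀ y : Fin N → ℂ, ‖(WithLp.toLp 2 y : EuclideanSpace ℂ (Fin N))‖
      = √(∑ q, ‖y q‖ ^ 2) := fun y => EuclideanSpace.norm_eq _
  have h3 : inner ℂ (WithLp.toLp 2 fun q => conj (w q))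
      (Matrix.toEuclideanCLM (n := Fin N) (𝕜 := ℂ) A (WithLp.toLp 2 v))
      = ∑ q, (∑ r, A q r * v r) * w q := by
    rw [Matrix.toEuclideanCLM_toLp, PiLp.inner_apply]
    simp [Matrix.mulVec, dotProduct]
  rw [h3, hn] at h2
  rw [hn v] at h1
  simp only [RCLike.norm_conj] at h2
  refine h2.trans ?_
  rw [mul_comm]
  exact mul_le_mul_of_nonneg_right h1 (Real.sqrt_nonneg _)

theorem norm_kernelK_le {d : ℕ} (hd : 1 ≤ d) {B : (l : ℕ) → Fin (dimHarm d l) → Sph d → ℂ}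
    (hB : ∀ l, IsHarmonicONB d l (B l)) (g : SO d → ℝ) (T : ℝ) (x z : Sph d) :
    ‖kernelK d B g T x z‖ ≤ ∑ l ∈ Finset.range (⌊T⌋₊ + 1),
      invNorm d B g l * (dimHarm d l / (nu d).real Set.univ) := by
  refine (norm_sum_le _ _).trans (Finset.sum_le_sum fun l _ => ?_)
  refine (norm_sum_mulVec_mul_le _ _ _).trans (le_of_eq ?_)
  simp only [RCLike.norm_conj]
  rw [sum_norm_sq_eq hd hB, sum_norm_sq_eq hd hB, mul_assoc, Real.mul_self_sqrt
    (div_nonneg (Nat.cast_nonneg _) (nu_univ_pos d).le)]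
  rfl

theorem continuous_kernelK {d : ℕ} {B : (l : ℕ) → Fin (dimHarm d l) → Sph d → ℂ}
    (hB : ∀ l, IsHarmonicONB d l (B l)) (g : SO d → ℝ) (T : ℝ) (x : Sph d) :
    Continuous (kernelK d B g T x) := by
  have := fun l q => (hB l).continuous q
  unfold kernelK
  fun_prop

/-! ### Expectation of the kernel -/

theorem continuous_rotCoeff {d : ℕ} {B : (l : ℕ) → Fin (dimHarm d l) → Sph d → ℂ}
    (hB : ∀ l, IsHarmonicONB d l (B l)) (l : ℕ) (q r : Fin (dimHarm d l)) :
    Continuous (rotCoeff d B l q r) := by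
  have hq := (hB l).continuous q
  have hr := (hB l).continuous r
  have hrot := continuous_rot (d := d)
  have h := continuous_parametric_integral_of_continuous (μ := nu d)
    (f := fun (u : SO d) (x : Sph d) => conj (B l q (rot u x)) * B l r x)
    (by
      change Continuous fun p : SO d × Sph d => conj (B l q (rot p.1 p.2)) * B l r p.2
      fun_prop) isCompact_univ
  simp only [Measure.restrict_univ] at h
  exact h

theorem integral_comp_of_density {Ω S : Type*} [MeasurableSpace Ω] [MeasurableSpace S]
    {P : Measure Ω} {W : Ω → S} (hW : Measurable W) {ρ : Measure S} {f : S → ℝ}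
    (hf : Measurable f) (hf0 : ∀ s, 0 ≤ f s)
    (hdens : P.map W = ρ.withDensity fun s => ENNReal.ofReal (f s)) {h : S → ℂ}
    (hh : Measurable h) : ∫ ω, h (W ω) ∂P = ∫ s, (f s : ℂ) * h s ∂ρ := by
  rw [← integral_map hW.aemeasurable hh.aestronglyMeasurable, hdens,
    integral_withDensity_eq_integral_toReal_smul hf.ennreal_ofReal (by simp)]
  refine integral_congr_ae (ae_of_all _ fun s => ?_)
  simp [ENNReal.toReal_ofReal (hf0 s)]

/-- The expected kernel is the truncated Fourier-Laplace series of the target density. -/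
theorem integral_kernelK {d : ℕ} {B : (l : ℕ) → Fin (dimHarm d l) → Sph d → ℂ}
    (hB : ∀ l, IsHarmonicONB d l (B l))
    {Ω : Type*} [MeasurableSpace Ω] {P : Measure Ω} [IsProbabilityMeasure P]
    {X : Ω → Sph d} {U : Ω → SO d} (hX : Measurable X) (hU : Measurable U)
    (hUX : IndepFun U X P)
    {fX : Sph d → ℝ} (hfX_meas : Measurable fX) (hfX_nonneg : ∀ x, 0 ≤ fX x)
    (hfX_dens : P.map X = (nu d).withDensity fun x => ENNReal.ofReal (fX x))
    {fU : SO d → ℝ} (hfU_meas : Measurable fU) (hfU_nonneg : ∀ u, 0 ≤ fU u)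
    (hfU_dens : P.map U = (muSO d).withDensity fun u => ENNReal.ofReal (fU u))
    (hfU_inv : ∀ l, IsUnit (rotFourier d B (fun u => (fU u : ℂ)) l))
    (T : ℝ) (x : Sph d) :
    ∫ ω, kernelK d B fU T x (rot (U ω) (X ω)) ∂P
      = ∑ l ∈ Finset.range (⌊T⌋₊ + 1), ∑ q, sphFourier d B (fun y => (fX y : ℂ)) l q * B l q x := by
  have hcont := fun l q => (hB l).continuous q
  have hDc := fun l q r => continuous_rotCoeff hB l q r
  have hbound : ∀ {S : Type} [TopologicalSpace S] [CompactSpace S] [MeasurableSpace S]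
      [BorelSpace S] (h : S → ℂ) (W : Ω → S), Continuous h → Measurable W →
      ∃ C, ∀ ω, ‖h (W ω)‖ ≤ C := by
    intro S _ _ _ _ h W hh hW
    obtain ⟨C, hC⟩ := isCompact_univ.exists_bound_of_continuousOn (f := h) hh.continuousOn
    exact ⟨C, fun ω => hC _ trivial⟩
  have hDB : ∀ l r s, Integrable
      (fun ω => rotCoeff d B l r s (U ω) * conj (B l s (X ω))) P := fun l r s => by
    have hD := hDc l r s
    have hb := hcont l s
    obtain ⟨C1, h1⟩ := hbound _ U hD hU
    obtain ⟨C2, h2⟩ := hbound _ X hb hX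
    refine Integrable.of_bound (C := C1 * C2) ?_ (ae_of_all _ fun ω => ?_)
    · exact ((hD.measurable.comp hU).mul
        ((Complex.continuous_conj.comp hb).measurable.comp hX)).aestronglyMeasurable
    · rw [norm_mul, RCLike.norm_conj]
      exact mul_le_mul (h1 ω) (h2 ω) (norm_nonneg _) ((norm_nonneg _).trans (h1 ω))
  have hBr : ∀ l r, Integrable (fun ω => conj (B l r (rot (U ω) (X ω)))) P := fun l r => by
    simp only [IsHarmonicONB.conj_comp_rot hB]
    exact integrable_finsetSum _ fun s _ => hDB l r s
  -- The convolution theorem: expanding in D^l(U) separates U from X, and independence factors each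
  -- expectation.
  have hE : ∀ l r, ∫ ω, conj (B l r (rot (U ω) (X ω))) ∂P
      = ∑ s, rotFourier d B (fun u => (fU u : ℂ)) l r s *
          sphFourier d B (fun y => (fX y : ℂ)) l s := fun l r => by
    simp only [IsHarmonicONB.conj_comp_rot hB]
    rw [integral_finsetSum _ fun s _ => hDB l r s]
    refine Finset.sum_congr rfl fun s _ => ?_
    have hD := hDc l r s
    have hb := Complex.continuous_conj.comp (hcont l s)
    have := hUX.integral_fun_comp_mul_comp hU.aemeasurable hX.aemeasurable
      (f := rotCoeff d B l r s) (g := fun y => conj (B l s y))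
      hD.measurable.aestronglyMeasurable hb.measurable.aestronglyMeasurable
    rw [this, integral_comp_of_density hU hfU_meas hfU_nonneg hfU_dens hD.measurable,
      integral_comp_of_density hX hfX_meas hfX_nonneg hfX_dens
        (h := fun y => conj (B l s y)) hb.measurable]
    rfl
  unfold kernelK
  have hI1 : ∀ l q r, Integrable (fun ω => (rotFourier d B (fun u => (fU u : ℂ)) l)⁻¹ q r *
      conj (B l r (rot (U ω) (X ω)))) P := fun l q r => (hBr l r).const_mul _
  have hI2 : ∀ l q, Integrable (fun ω => (∑ r, (rotFourier d B (fun u => (fU u : ℂ)) l)⁻¹ q r *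
      conj (B l r (rot (U ω) (X ω)))) * B l q x) P := fun l q =>
    (integrable_finsetSum _ fun r _ => hI1 l q r).mul_const _
  rw [integral_finsetSum _ fun l _ => integrable_finsetSum _ fun q _ => hI2 l q]
  refine Finset.sum_congr rfl fun l _ => ?_
  rw [integral_finsetSum _ fun q _ => hI2 l q]
  refine Finset.sum_congr rfl fun q _ => ?_
  rw [integral_mul_const, integral_finsetSum _ fun r _ => hI1 l q r]
  congr 1
  simp only [integral_const_mul, hE]
  set Φ := rotFourier d B (fun u => (fU u : ℂ)) l with hΦ
  have hinv : Φ⁻¹ * Φ = 1 := Matrix.nonsing_inv_mul _ ((Matrix.isUnit_iff_isUnit_det _).1 (hfU_inv l))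
  have : Φ⁻¹.mulVec (Φ.mulVec fun s => sphFourier d B (fun y => (fX y : ℂ)) l s)
      = fun s => sphFourier d B (fun y => (fX y : ℂ)) l s := by
    rw [Matrix.mulVec_mulVec, hinv, Matrix.one_mulVec]
  exact congrFun this q

/-! ## Growth of the dimension -/

theorem dimHarm_le {d l : ℕ} (hd : 1 ≤ d) (hl : 1 ≤ l) :
    dimHarm d l ≤ ((d + 1) * d ^ (d - 1)) * l ^ (d - 1) := by
  obtain ⟨e, rfl⟩ : ∃ e, d = e + 1 := ⟨d - 1, by omega⟩
  obtain ⟨k, rfl⟩ : ∃ k, l = k + 1 := ⟨l - 1, by omega⟩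
  rw [dimHarm, if_neg (by omega)]
  have e1 : k + 1 + (e + 1) - 2 = k + e := by omega
  have e2 : 2 * (k + 1) + (e + 1) - 1 = 2 * (k + 1) + e := by omega
  have e3 : e + 1 - 1 = e := by omega
  rw [e1, e2, e3]
  refine Nat.div_le_of_le_mul ?_
  have h1 : (k + e).factorial ≤ k.factorial * (k + e) ^ e := by
    rw [← Nat.factorial_mul_ascFactorial]
    exact Nat.mul_le_mul_left _ (Nat.ascFactorial_le_pow_add k e)
  have h2 : k + e ≤ (e + 1) * (k + 1) := by nlinarith
  have h3 : 2 * (k + 1) + e ≤ (e + 1 + 1) * (k + 1) := by nlinarith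
  calc (2 * (k + 1) + e) * (k + e).factorial
      ≤ ((e + 1 + 1) * (k + 1)) * (k.factorial * ((e + 1) * (k + 1)) ^ e) :=
        Nat.mul_le_mul h3 (h1.trans (Nat.mul_le_mul_left _ (Nat.pow_le_pow_left h2 e)))
    _ = (k + 1).factorial * 1 * ((e + 1 + 1) * (e + 1) ^ e * (k + 1) ^ e) := by
        rw [mul_pow, Nat.factorial_succ]; ring
    -- The factor (d-1)! in the denominator is at least 1 and is simply discarded.
    _ ≤ _ := by
        gcongr
        exact Nat.factorial_pos e

/-! ## Unboundedness of the inverse Fourier transform of a square integrable density -/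

/-- Averaging over an orbit of the rotation group is averaging over the sphere. -/
theorem integral_orbit {d : ℕ} (hd : 1 ≤ d) {F : Sph d → ℂ} (hF : Continuous F) (x : Sph d) :
    ∫ u, F (rot u x) ∂(muSO d) = (((nu d).real Set.univ)⁻¹ : ℝ) * ∫ y, F y ∂(nu d) := by
  -- Right invariance makes the orbit average independent of the base point, so it may be averaged
  -- over the sphere and the integrals exchanged.
  have hconst : ∀ y, ∫ u, F (rot u y) ∂(muSO d) = ∫ u, F (rot u x) ∂(muSO d) := fun y => by
    obtain ⟨v, rfl⟩ := exists_rot_eq hd x y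
    simp only [← rot_mul]
    exact integral_mul_right_eq_self (fun u => F (rot u x)) v
  have hrot := continuous_rot (d := d)
  have hswap : ∫ y, ∫ u, F (rot u y) ∂(muSO d) ∂(nu d)
      = ∫ u, ∫ y, F (rot u y) ∂(nu d) ∂(muSO d) :=
    integral_integral_swap_of_hasCompactSupport (f := fun y u => F (rot u y))
      (by
        change Continuous fun p : Sph d × SO d => F (rot p.2 p.1)
        exact hF.comp (hrot.comp continuous_swap))
      (HasCompactSupport.of_compactSpace _)
  simp only [hconst, integral_comp_rot, integral_const, probReal_univ, one_smul] at hswap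
  rw [← hswap, Complex.real_smul, ← mul_assoc, ← Complex.ofReal_mul,
    inv_mul_cancel₀ (nu_univ_pos d).ne', Complex.ofReal_one, one_mul]

/-- Two reflections along unit vectors at angle a in the first coordinate plane compose to the
rotation by 2a there, which multiplies x₀ + i x₁ by exp(2ia). -/
theorem exists_rot_plane {d : ℕ} (hd : 1 ≤ d) (a : ℝ) : ∃ u : SO d, ∀ l x,
    planeHarmonic hd l (rot u x) = Complex.exp (2 * a * Complex.I) ^ l * planeHarmonic hd l x := by
  have h10 : (⟨1, by omega⟩ : Fin (d + 1)) ≠ 0 := by simp [Fin.ext_iff]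
  set j : Fin (d + 1) := ⟨1, by omega⟩ with hj
  have hv : ∀ s : ℝ, ∃ v : Fin (d + 1) → ℝ, v ⬝ᵥ v = 1 ∧ (∀ w, v ⬝ᵥ w
      = Real.cos s * w 0 + Real.sin s * w j) ∧ v 0 = Real.cos s ∧ v j = Real.sin s := fun s => by
    have h : ∀ w, (Pi.single 0 (Real.cos s) + Pi.single j (Real.sin s)) ⬝ᵥ w
        = Real.cos s * w 0 + Real.sin s * w j := fun w => by
      rw [add_dotProduct, single_dotProduct, single_dotProduct]
    refine ⟨_, ?_, h, by simp [h10.symm], by simp [h10]⟩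
    rw [h]
    simp only [Pi.add_apply, Pi.single_eq_same, Pi.single_eq_of_ne h10, Pi.single_eq_of_ne h10.symm]
    nlinarith [Real.sin_sq_add_cos_sq s]
  obtain ⟨v, hvv, hvw, hv0, hv1⟩ := hv 0
  obtain ⟨w, hww, hwv, hw0, hw1⟩ := hv a
  refine ⟨⟨_, householder_mul_mem (hww ▸ one_ne_zero) (hvv ▸ one_ne_zero)⟩, fun l x => ?_⟩
  rw [planeHarmonic, planeHarmonic, ← mul_pow]
  congr 1
  set p : Fin (d + 1) → ℝ := WithLp.ofLp x.1 with hp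
  have hr : ∀ i, (rot (⟨_, householder_mul_mem (hww ▸ one_ne_zero) (hvv ▸ one_ne_zero)⟩ : SO d)
      x).1 i = (householder w).mulVec ((householder v).mulVec p) i := fun i => by
    rw [Matrix.mulVec_mulVec]; rfl
  rw [hr, hr]
  simp only [householder_mulVec, Pi.sub_apply, Pi.smul_apply, smul_eq_mul, hvv, hww, hwv, hvw,
    hv0, hv1, hw0, hw1, Real.cos_zero, Real.sin_zero, ← hj]
  have he : Complex.exp (2 * a * Complex.I)
      = (Real.cos (2 * a) : ℂ) + (Real.sin (2 * a) : ℂ) * Complex.I := by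
    rw [show (2 * a * Complex.I : ℂ) = ((2 * a : ℝ) : ℂ) * Complex.I by push_cast; ring,
      Complex.exp_mul_I, Complex.ofReal_cos, Complex.ofReal_sin]
  have hsc := Real.sin_sq_add_cos_sq a
  rw [he, Real.cos_two_mul, Real.sin_two_mul]
  generalize Real.cos a = C at hsc ⊢
  generalize Real.sin a = D at hsc ⊢
  apply Complex.ext
  · simp [pow_two]
    ring
  · simp [pow_two]
    linear_combination (-2 * p j) * hsc

theorem integral_planeHarmonic_mul_conj {d : ℕ} (hd : 1 ≤ d) {l m : ℕ} (hlm : l ≠ m) :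
    ∫ x, planeHarmonic hd l x * conj (planeHarmonic hd m x) ∂(nu d) = 0 := by
  have hne : ((l : ℝ) - m) ≠ 0 := sub_ne_zero.2 (by exact_mod_cast hlm)
  -- The rotation angle π/(l - m) multiplies the integrand by exp(iπ) = -1, so the invariant
  -- integral equals its own negative.
  obtain ⟨u, hu⟩ := exists_rot_plane hd (Real.pi / (2 * ((l : ℝ) - m)))
  set I := ∫ x, planeHarmonic hd l x * conj (planeHarmonic hd m x) ∂(nu d) with hI
  set z := Complex.exp (2 * (Real.pi / (2 * ((l : ℝ) - m)) : ℝ) * Complex.I) with hz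
  have hzz : z ^ l * conj (z ^ m) = -1 := by
    rw [map_pow, hz, ← Complex.exp_conj, ← Complex.exp_nat_mul, ← Complex.exp_nat_mul,
      ← Complex.exp_add, ← Complex.exp_pi_mul_I]
    congr 1
    have hne' : ((l : ℂ) - m) ≠ 0 := by exact_mod_cast hne
    simp only [map_mul, Complex.conj_I, Complex.conj_ofReal, map_ofNat]
    push_cast
    field_simp
    ring
  have h1 : I = -1 * I := by
    conv_lhs => rw [hI, ← integral_comp_rot u]
    rw [hI, ← integral_const_mul]
    refine integral_congr_ae (ae_of_all _ fun x => ?_)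
    simp only [hu]
    rw [map_mul, ← hzz]
    ring
  have : 2 * I = 0 := by linear_combination h1
  simpa using this

/-- Bessel's inequality for the coefficients of a function against an orthogonal family. -/
theorem sum_norm_sq_integral_le {S : Type*} [MeasurableSpace S] {ρ : Measure S} {f : S → ℂ}
    (hf : MemLp f 2 ρ) {e : ℕ → S → ℂ} (he : ∀ i, MemLp (e i) 2 ρ)
    (horth : ∀ i j, ∫ s, e j s * conj (e i s) ∂ρ = if i = j then 1 else 0) (t : Finset ℕ) :
    ∑ i ∈ t, ‖∫ s, f s * conj (e i s) ∂ρ‖ ^ 2 ≤ ‖hf.toLp f‖ ^ 2 := by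
  have hin : ∀ {g h : S → ℂ} (hg : MemLp g 2 ρ) (hh : MemLp h 2 ρ),
      inner ℂ (hg.toLp g) (hh.toLp h) = ∫ s, h s * conj (g s) ∂ρ := fun hg hh => by
    rw [L2.inner_def]
    refine integral_congr_ae ?_
    filter_upwards [hg.coeFn_toLp, hh.coeFn_toLp] with s h1 h2
    rw [h1, h2]
    simp [RCLike.inner_apply]
  have ho : Orthonormal ℂ fun i => (he i).toLp (e i) := by
    classical
    rw [orthonormal_iff_ite]
    intro i j
    rw [hin, horth]
  have := ho.sum_inner_products_le (hf.toLp f) (s := t)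
  simpa only [hin] using this

theorem IsHarmonicONB.integral_norm_sq_sum {d l : ℕ} {b : Fin (dimHarm d l) → Sph d → ℂ}
    (h : IsHarmonicONB d l b) (k : Fin (dimHarm d l) → ℂ) :
    ∫ x, ‖∑ r, k r * conj (b r x)‖ ^ 2 ∂(nu d) = ∑ r, ‖k r‖ ^ 2 := by
  have hc := h.continuous
  have h1 : ∫ x, ((‖∑ r, k r * conj (b r x)‖ ^ 2 : ℝ) : ℂ) ∂(nu d)
      = ((∑ r, ‖k r‖ ^ 2 : ℝ) : ℂ) := by
    have : ∀ x, ((‖∑ r, k r * conj (b r x)‖ ^ 2 : ℝ) : ℂ)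
        = ∑ r, ∑ s, k r * conj (k s) * (b s x * conj (b r x)) := fun x => by
      rw [← Complex.normSq_eq_norm_sq, ← Complex.mul_conj, map_sum, Finset.sum_mul_sum]
      refine Finset.sum_congr rfl fun r _ => Finset.sum_congr rfl fun s _ => ?_
      rw [map_mul, Complex.conj_conj]
      ring
    simp only [this]
    rw [integral_finsetSum _ fun r _ => integrable_nu_of_continuous (by fun_prop)]
    push_cast
    refine Finset.sum_congr rfl fun r _ => ?_
    rw [integral_finsetSum _ fun s _ => integrable_nu_of_continuous (by fun_prop)]
    have : ∀ s, ∫ x, k r * conj (k s) * (b s x * conj (b r x)) ∂(nu d)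
        = k r * conj (k s) * if s = r then 1 else 0 := fun s => by
      rw [integral_const_mul]
      congr 1
      exact h.orthonormal s r
    simp only [this]
    simp [Complex.mul_conj, Complex.normSq_eq_norm_sq]
  rw [integral_complex_ofReal] at h1
  exact_mod_cast h1

/-- With k = aA, write ‖a‖² as the pairing of A⁻¹ conj(a) with k, bound it by ‖A⁻¹‖ ‖a‖ ‖k‖, and
divide by ‖a‖. This handles row vectors without the norm of a transpose. -/
theorem sum_norm_sq_le_of_vecMul {N : ℕ} {A : Matrix (Fin N) (Fin N) ℂ} (hA : IsUnit A)
    (a : Fin N → ℂ) :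
    ∑ q, ‖a q‖ ^ 2 ≤ opNorm A⁻¹ ^ 2 * ∑ r, ‖Matrix.vecMul a A r‖ ^ 2 := by
  set k := Matrix.vecMul a A with hk
  have hak : a = Matrix.vecMul k A⁻¹ := by
    rw [hk, Matrix.vecMul_vecMul, Matrix.mul_nonsing_inv _ ((Matrix.isUnit_iff_isUnit_det _).1 hA),
      Matrix.vecMul_one]
  have h1 : ((∑ q, ‖a q‖ ^ 2 : ℝ) : ℂ) = ∑ r, (∑ q, A⁻¹ r q * conj (a q)) * k r := by
    push_cast
    calc ∑ q, ((‖a q‖ : ℂ)) ^ 2 = ∑ q, Matrix.vecMul k A⁻¹ q * conj (a q) := by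
          rw [← hak]
          refine Finset.sum_congr rfl fun q _ => ?_
          rw [Complex.mul_conj, Complex.normSq_eq_norm_sq]
          push_cast
          rfl
      _ = _ := by
          simp only [Matrix.vecMul, dotProduct, Finset.sum_mul]
          rw [Finset.sum_comm]
          exact Finset.sum_congr rfl fun r _ => Finset.sum_congr rfl fun q _ => by ring
  have h2 := norm_sum_mulVec_mul_le A⁻¹ (fun q => conj (a q)) k
  rw [← h1, Complex.norm_real, Real.norm_of_nonneg (Finset.sum_nonneg fun _ _ => sq_nonneg _)] at h2
  simp only [RCLike.norm_conj] at h2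
  set S := ∑ q, ‖a q‖ ^ 2 with hS
  have hS0 : 0 ≤ S := Finset.sum_nonneg fun _ _ => sq_nonneg _
  have hK0 : 0 ≤ ∑ r, ‖k r‖ ^ 2 := Finset.sum_nonneg fun _ _ => sq_nonneg _
  rcases hS0.eq_or_lt with h0 | h0
  · rw [← h0]; positivity
  · have hs : 0 < √S := Real.sqrt_pos.2 h0
    have h3 : √S ≤ opNorm A⁻¹ * √(∑ r, ‖k r‖ ^ 2) := by
      refine le_of_mul_le_mul_right ?_ hs
      rw [Real.mul_self_sqrt hS0]
      linarith
    calc S = √S ^ 2 := (Real.sq_sqrt hS0).symm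
      _ ≤ (opNorm A⁻¹ * √(∑ r, ‖k r‖ ^ 2)) ^ 2 := pow_le_pow_left₀ hs.le h3 2
      _ = _ := by rw [mul_pow, Real.sq_sqrt hK0]

theorem integral_norm_sq_planeHarmonic_pos {d : ℕ} (hd : 1 ≤ d) (l : ℕ) :
    0 < ∫ x, ‖planeHarmonic hd l x‖ ^ 2 ∂(nu d) := by
  have hc := continuous_of_mem_harmonicSpace (planeHarmonic_mem (d := d) hd l)
  have : (nu d).IsOpenPosMeasure := by unfold nu; infer_instance
  let x0 : Sph d := ⟨EuclideanSpace.single 0 1, by simp⟩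
  refine Continuous.integral_pos_of_hasCompactSupport_nonneg_nonzero (x := x0) (by fun_prop)
    (HasCompactSupport.of_compactSpace _) (fun _ => by positivity) ?_
  have h10 : (⟨1, by omega⟩ : Fin (d + 1)) ≠ 0 := by simp [Fin.ext_iff]
  simp [planeHarmonic, x0, h10]

/-- One harmonic h_l per degree suffices. For fixed x the functions u ↦ h_l(ux) are orthogonal in
L²(μ), so Bessel bounds the sum of the squared normalised coefficients of f_U by ‖f_U‖². Integrated
over x, a bound c on the inverses would make each degree contribute at least a fixed positive
amount, so L degrees would give L ≤ c²‖f_U‖² for every L. -/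
theorem not_bddAbove_invNorm {d : ℕ} (hd : 1 ≤ d) {B : (l : ℕ) → Fin (dimHarm d l) → Sph d → ℂ}
    (hB : ∀ l, IsHarmonicONB d l (B l)) {fU : SO d → ℝ} (hfU_sq : MemLp fU 2 (muSO d))
    (hfU_inv : ∀ l, IsUnit (rotFourier d B (fun u => (fU u : ℂ)) l)) (c : ℝ) :
    ¬ ∀ l : ℕ, 1 ≤ l → invNorm d B fU l ≤ c := by
  intro hc
  set S := (nu d).real Set.univ with hS
  have hSpos : 0 < S := nu_univ_pos d
  set h : ℕ → Sph d → ℂ := fun l => planeHarmonic hd l with hh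
  have hcont : ∀ l, Continuous (h l) := fun l =>
    continuous_of_mem_harmonicSpace (planeHarmonic_mem hd l)
  set A : ℕ → ℝ := fun l => ∫ x, ‖h l x‖ ^ 2 ∂(nu d) with hA
  have hApos : ∀ l, 0 < A l := fun l => integral_norm_sq_planeHarmonic_pos hd l
  set a : (l : ℕ) → Fin (dimHarm d l) → ℂ := fun l r => conj (innerL2 d (h l) (B l r)) with ha
  have hexp : ∀ l x, conj (h l x) = ∑ r, a l r * conj (B l r x) := fun l x => by
    rw [(hB l).eq_sum (f := h l) (planeHarmonic_mem hd l) x, map_sum]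
    exact Finset.sum_congr rfl fun r _ => by rw [map_mul]
  have hAa : ∀ l, A l = ∑ r, ‖a l r‖ ^ 2 := fun l => by
    rw [← (hB l).integral_norm_sq_sum]
    simp only [← hexp, RCLike.norm_conj]
    rfl
  set f : SO d → ℂ := fun u => (fU u : ℂ) with hf
  have hfL : MemLp f 2 (muSO d) := hfU_sq.ofReal
  have hfI : Integrable f (muSO d) := hfL.integrable (by norm_num)
  set k : (l : ℕ) → Fin (dimHarm d l) → ℂ := fun l => Matrix.vecMul (a l) (rotFourier d B f l)
    with hk
  -- As a function of x, the coefficient of f_U along the orbit is a conjugate harmonic whose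
  -- coordinates are those of h_l multiplied by the Fourier matrix.
  have hG : ∀ l x, ∫ u, f u * conj (h l (rot u x)) ∂(muSO d) = ∑ r, k l r * conj (B l r x) := by
    intro l x
    have hint : ∀ q r, Integrable (fun u => f u * rotCoeff d B l q r u) (muSO d) := fun q r => by
      obtain ⟨C, hC⟩ := isCompact_univ.exists_bound_of_continuousOn
        (continuous_rotCoeff hB l q r).continuousOn
      exact hfI.mul_bdd (c := C) (continuous_rotCoeff hB l q r).aestronglyMeasurable
        (ae_of_all _ fun u => hC u trivial)
    have e : ∀ u, f u * conj (h l (rot u x))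
        = ∑ q, ∑ r, (f u * rotCoeff d B l q r u) * (a l q * conj (B l r x)) := fun u => by
      rw [hexp, Finset.mul_sum]
      refine Finset.sum_congr rfl fun q _ => ?_
      rw [IsHarmonicONB.conj_comp_rot hB, Finset.mul_sum, Finset.mul_sum]
      exact Finset.sum_congr rfl fun r _ => by ring
    simp only [e]
    rw [integral_finsetSum _ fun q _ => integrable_finsetSum _ fun r _ => (hint q r).mul_const _]
    simp only [hk, Matrix.vecMul, dotProduct, Finset.sum_mul]
    rw [Finset.sum_comm]
    refine Finset.sum_congr rfl fun q _ => ?_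
    rw [integral_finsetSum _ fun r _ => (hint q r).mul_const _]
    refine Finset.sum_congr rfl fun r _ => ?_
    rw [integral_mul_const]
    simp only [rotFourier, Matrix.of_apply]
    ring
  have hbessel : ∀ (L : ℕ) x, ∑ l ∈ Finset.range L,
      S / A (l + 1) * ‖∑ r, k (l + 1) r * conj (B (l + 1) r x)‖ ^ 2 ≤ ‖hfL.toLp f‖ ^ 2 := by
    intro L x
    -- By `integral_orbit` the squared norm of u ↦ h_l(ux) is A_l/S, whence the factor. The shift by
    -- one skips degree 0, which the assumed bound does not cover.
    set e : ℕ → SO d → ℂ := fun l u => (√(S / A (l + 1)) : ℂ) * h (l + 1) (rot u x) with he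
    have hecont : ∀ l, Continuous (e l) := fun l =>
      continuous_const.mul ((hcont _).comp (continuous_rot_left x))
    have heL : ∀ l, MemLp (e l) 2 (muSO d) := fun l =>
      (hecont l).memLp_of_hasCompactSupport (HasCompactSupport.of_compactSpace _)
    have horth : ∀ i j, ∫ u, e j u * conj (e i u) ∂(muSO d) = if i = j then 1 else 0 := by
      intro i j
      have e1 : ∫ u, e j u * conj (e i u) ∂(muSO d)
          = ((√(S / A (j + 1)) : ℂ) * (√(S / A (i + 1)) : ℂ)) *
            ∫ u, (fun y => h (j + 1) y * conj (h (i + 1) y)) (rot u x) ∂(muSO d) := by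
        rw [← integral_const_mul]
        refine integral_congr_ae (ae_of_all _ fun u => ?_)
        simp only [he, map_mul, Complex.conj_ofReal]
        ring
      rw [e1, integral_orbit hd (F := fun y => h (j + 1) y * conj (h (i + 1) y))
        ((hcont _).mul (Complex.continuous_conj.comp (hcont _)))]
      split_ifs with hij
      · subst hij
        have : ∫ y, h (i + 1) y * conj (h (i + 1) y) ∂(nu d) = (A (i + 1) : ℂ) := by
          rw [hA]
          simp only
          rw [← integral_complex_ofReal]
          refine integral_congr_ae (ae_of_all _ fun y => ?_)
          simp only [Complex.mul_conj, Complex.normSq_eq_norm_sq]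
        rw [this, ← Complex.ofReal_mul, ← Complex.ofReal_mul, ← Complex.ofReal_mul,
          Real.mul_self_sqrt (div_pos hSpos (hApos _)).le]
        have := (hApos (i + 1)).ne'
        rw [← Complex.ofReal_one]
        congr 1
        rw [← hS]
        field_simp
      · rw [integral_planeHarmonic_mul_conj hd (by omega), mul_zero, mul_zero]
    refine le_trans (le_of_eq ?_) (sum_norm_sq_integral_le hfL heL horth (Finset.range L))
    refine Finset.sum_congr rfl fun l _ => ?_
    have : ∫ u, f u * conj (e l u) ∂(muSO d)
        = (√(S / A (l + 1)) : ℂ) * ∫ u, f u * conj (h (l + 1) (rot u x)) ∂(muSO d) := by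
      rw [← integral_const_mul]
      refine integral_congr_ae (ae_of_all _ fun u => ?_)
      simp only [he, map_mul, Complex.conj_ofReal]
      ring
    rw [this, hG, norm_mul, mul_pow, Complex.norm_real, Real.norm_of_nonneg (Real.sqrt_nonneg _),
      Real.sq_sqrt (div_pos hSpos (hApos _)).le]
  have hterm : ∀ l, 1 ≤ l → A l ≤ c ^ 2 * ∑ r, ‖k l r‖ ^ 2 := fun l hl => by
    rw [hAa]
    refine (sum_norm_sq_le_of_vecMul (hfU_inv l) (a l)).trans ?_
    have := hc l hl
    have h0 : 0 ≤ invNorm d B fU l := opNorm_nonneg _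
    exact mul_le_mul_of_nonneg_right (pow_le_pow_left₀ h0 this 2)
      (Finset.sum_nonneg fun _ _ => sq_nonneg _)
  have hL : ∀ L : ℕ, (L : ℝ) ≤ c ^ 2 * ‖hfL.toLp f‖ ^ 2 := by
    intro L
    have hBc := fun l q => (hB l).continuous q
    have hi : ∀ l ∈ Finset.range L, Integrable (fun x => S / A (l + 1) *
        ‖∑ r, k (l + 1) r * conj (B (l + 1) r x)‖ ^ 2) (nu d) := fun l _ =>
      integrable_nu_of_continuous (by fun_prop)
    -- Integrating over the base point replaces the pointwise values by ‖k_l‖² through Parseval.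
    have h1 := integral_mono (integrable_finsetSum _ hi) (integrable_const _) (hbessel L)
    rw [integral_finsetSum _ hi, integral_const, smul_eq_mul, ← hS] at h1
    simp only [integral_const_mul, (hB _).integral_norm_sq_sum] at h1
    have h2 : ∀ l ∈ Finset.range L, S ≤ c ^ 2 * (S / A (l + 1) * ∑ r, ‖k (l + 1) r‖ ^ 2) := by
      intro l _
      have h3 := hterm (l + 1) (by omega)
      have h4 := hApos (l + 1)
      calc S = S / A (l + 1) * A (l + 1) := by field_simp
        _ ≤ S / A (l + 1) * (c ^ 2 * ∑ r, ‖k (l + 1) r‖ ^ 2) :=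
          mul_le_mul_of_nonneg_left h3 (div_pos hSpos h4).le
        _ = _ := by ring
    have h5 := Finset.sum_le_sum h2
    rw [← Finset.mul_sum, Finset.sum_const, Finset.card_range, nsmul_eq_mul] at h5
    have h6 := mul_le_mul_of_nonneg_left h1 (sq_nonneg c)
    refine le_of_mul_le_mul_right ?_ hSpos
    calc (L : ℝ) * S ≤ _ := h5
      _ ≤ _ := h6
      _ = _ := by ring
  obtain ⟨L, hL'⟩ := exists_nat_gt (c ^ 2 * ‖hfL.toLp f‖ ^ 2)
  exact absurd (hL L) (not_le.2 hL')

/-! ## Growth of the kernel bound in the three scenarios -/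

/-- At most T positive degrees, each of dimension of order at most T^(d-1), give T^d H. Degree 0,
which the growth conditions leave free, is absorbed in the constant; the constant depends on neither
T nor H. -/
theorem exists_sum_mul_dimHarm_le {d : ℕ} (hd : 1 ≤ d) (s : ℕ → ℝ) {S : ℝ} (hS : 0 < S) :
    ∃ C > 0, ∀ T : ℝ, 1 ≤ T → ∀ H : ℝ, 0 ≤ H → (∀ l : ℕ, 1 ≤ l → (l : ℝ) ≤ T → s l ≤ H) →
      ∑ l ∈ Finset.range (⌊T⌋₊ + 1), s l * (dimHarm d l / S) ≤ C * (1 + T ^ d * H) := by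
  set D : ℝ := (d + 1) * d ^ (d - 1) with hD
  have hD0 : 0 ≤ D := by positivity
  set E : ℝ := |s 0 * (dimHarm d 0 / S)| with hE
  refine ⟨E + D / S + 1, by positivity, fun T hT H hH hs => ?_⟩
  have hT0 : 0 ≤ T := zero_le_one.trans hT
  have hfl : (⌊T⌋₊ : ℝ) ≤ T := Nat.floor_le hT0
  rw [Finset.sum_range_succ']
  have hterm : ∀ l ∈ Finset.range ⌊T⌋₊,
      s (l + 1) * (dimHarm d (l + 1) / S) ≤ H * (D * T ^ (d - 1) / S) := fun l hl => by
    have hl' : ((l + 1 : ℕ) : ℝ) ≤ T :=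
      (Nat.cast_le.2 (Nat.succ_le_of_lt (Finset.mem_range.1 hl))).trans hfl
    have h1 : (dimHarm d (l + 1) : ℝ) ≤ D * ((l + 1 : ℕ) : ℝ) ^ (d - 1) := by
      rw [hD]
      exact_mod_cast dimHarm_le hd (by omega : 1 ≤ l + 1)
    have h2 : (dimHarm d (l + 1) : ℝ) ≤ D * T ^ (d - 1) :=
      h1.trans (mul_le_mul_of_nonneg_left (pow_le_pow_left₀ (Nat.cast_nonneg _) hl' _) hD0)
    calc s (l + 1) * (dimHarm d (l + 1) / S) ≤ H * (dimHarm d (l + 1) / S) :=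
          mul_le_mul_of_nonneg_right (hs _ (by omega) hl') (by positivity)
      _ ≤ _ := by gcongr
  have h3 := Finset.sum_le_card_nsmul _ _ _ hterm
  rw [Finset.card_range, nsmul_eq_mul] at h3
  have h4 : (⌊T⌋₊ : ℝ) * (H * (D * T ^ (d - 1) / S)) ≤ D / S * (T ^ d * H) := by
    calc (⌊T⌋₊ : ℝ) * (H * (D * T ^ (d - 1) / S)) ≤ T * (H * (D * T ^ (d - 1) / S)) := by gcongr
      _ = D / S * (T ^ (d - 1) * T * H) := by ring
      _ = _ := by rw [← pow_succ, Nat.sub_add_cancel hd]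
  have h5 : s 0 * (dimHarm d 0 / S) ≤ E := le_abs_self _
  have hE0 : 0 ≤ E := abs_nonneg _
  have hDS : 0 ≤ D / S := by positivity
  have hTH : 0 ≤ T ^ d * H := by positivity
  nlinarith [mul_nonneg hE0 hTH]

/-- The exponents γ and 2γ cancel in b²/M up to 3εY, and the factor 1/n beats this once ε is small.
-/
theorem tendsto_of_exp_bounds {Y b M : ℕ → ℝ} {γ : ℝ} (hγ : 0 < γ) (hY : Tendsto Y atTop atTop)
    (hK : Y =O[atTop] fun n : ℕ => Real.log n) (hb0 : ∀ᶠ n in atTop, 0 ≤ b n)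
    (hb : ∀ ε > 0, ∀ᶠ n in atTop, b n ≤ Real.exp ((γ + ε) * Y n))
    (hM : ∀ ε > 0, ∀ᶠ n in atTop, Real.exp ((2 * γ - ε) * Y n) ≤ M n) :
    Tendsto M atTop atTop ∧ Tendsto (fun n : ℕ => b n ^ 2 / (n * M n)) atTop (𝓝 0) := by
  constructor
  · refine tendsto_atTop_mono' _ (hM γ hγ) (Real.tendsto_exp_atTop.comp ?_)
    exact hY.const_mul_atTop (by linarith)
  · obtain ⟨K, hK0, hK⟩ := hK.exists_pos
    -- If Y ≤ K log n, this ε gives 3εY ≤ (1/2) log n, so b²/(nM) is at most n^(-1/2).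
    have hε : 0 < 1 / (6 * K) := by positivity
    have hlog : Tendsto (fun n : ℕ => Real.log n) atTop atTop :=
      Real.tendsto_log_atTop.comp tendsto_natCast_atTop_atTop
    have hlim : Tendsto (fun n : ℕ => Real.exp (-(1 / 2 * Real.log n))) atTop (𝓝 0) :=
      Real.tendsto_exp_neg_atTop_nhds_zero.comp (hlog.const_mul_atTop (by norm_num))
    refine squeeze_zero' ?_ ?_ hlim
    · filter_upwards [hM γ hγ] with n h1
      have : 0 ≤ M n := (Real.exp_pos _).le.trans h1
      positivity
    · filter_upwards [hb0, hb _ hε, hM _ hε, hK.bound, eventually_gt_atTop 0,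
        hlog.eventually_ge_atTop 0, hY.eventually_ge_atTop 0] with n h0 h1 h2 h3 h4 h5 h6
      have hn : (0 : ℝ) < n := by exact_mod_cast h4
      rw [Real.norm_of_nonneg h6, Real.norm_of_nonneg h5] at h3
      have hMp : 0 < M n := (Real.exp_pos _).trans_le h2
      rw [div_le_iff₀ (by positivity)]
      calc b n ^ 2 ≤ Real.exp ((γ + 1 / (6 * K)) * Y n) ^ 2 := pow_le_pow_left₀ h0 h1 2
        _ = Real.exp (3 * (1 / (6 * K)) * Y n) * Real.exp ((2 * γ - 1 / (6 * K)) * Y n) := by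
          rw [← Real.exp_nat_mul, ← Real.exp_add]
          congr 1
          push_cast
          ring
        _ ≤ Real.exp (1 / 2 * Real.log n) * M n := by
          refine mul_le_mul (Real.exp_le_exp.2 ?_) h2 (Real.exp_pos _).le (Real.exp_pos _).le
          calc 3 * (1 / (6 * K)) * Y n ≤ 3 * (1 / (6 * K)) * (K * Real.log n) := by gcongr
            _ = _ := by field_simp; ring
        _ = Real.exp (-(1 / 2 * Real.log n)) * (n * M n) := by
          have : (n : ℝ) = Real.exp (Real.log n) := (Real.exp_log hn).symm
          rw [← mul_assoc]
          congr 1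
          conv_rhs => rw [this, Real.log_exp, ← Real.exp_add]
          congr 1
          ring

/-- The common part of the two super-smooth scenarios, where the growth function `Y` dominates
`log t` and `κ t^β`. -/
theorem tendsto_of_superSmooth {d : ℕ} (hd : 1 ≤ d) {s M : ℕ → ℝ} {S : ℝ} (hS : 0 < S)
    (hs0 : ∀ l, 0 ≤ s l) (hM0 : ∀ n, 0 ≤ M n) {T : ℕ → ℝ} (hT : Tendsto T atTop atTop)
    {Y : ℝ → ℝ} {β γ a q κ : ℝ} (hβ : 0 < β) (hγ : 0 < γ) (hκ : 0 ≤ κ)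
    (hY0 : ∀ t, 1 ≤ t → 0 ≤ Y t)
    (hY : ∀ C A ε : ℝ, 0 < ε → ∀ᶠ t in atTop, C + A * Real.log t + κ * t ^ β ≤ ε * Y t)
    (hs : ∃ c > 0, ∀ t : ℝ, 1 ≤ t → ∀ l : ℕ, 1 ≤ l → (l : ℝ) ≤ t →
      s l ≤ c * t ^ |a| * Real.exp (γ * Y t + κ * t ^ β))
    (hM : ∀ η : ℝ, 0 < η → η < 1 → (fun n => T n ^ (2 * a + q) *
      Real.exp (2 * γ * η ^ β * Y (T n) - κ * T n ^ β)) =O[atTop] M)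
    (hK : (fun n => Y (T n)) =O[atTop] fun n : ℕ => Real.log n) :
    Tendsto M atTop atTop ∧ Tendsto (fun n : ℕ =>
      (∑ l ∈ Finset.range (⌊T n⌋₊ + 1), s l * (dimHarm d l / S)) ^ 2 / (n * M n)) atTop (𝓝 0) := by
  have hYt : Tendsto Y atTop atTop := by
    refine tendsto_atTop_mono' _ ?_ Real.tendsto_log_atTop
    filter_upwards [hY 0 1 1 one_pos, eventually_ge_atTop 0] with t h1 h2
    have : 0 ≤ κ * t ^ β := by positivity
    linarith
  refine tendsto_of_exp_bounds hγ (hYt.comp hT) hK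
    (Eventually.of_forall fun n => Finset.sum_nonneg fun l _ => mul_nonneg (hs0 l) (by positivity))
    ?_ ?_
  · intro ε hε
    obtain ⟨C, hC, hCb⟩ := exists_sum_mul_dimHarm_le hd s hS
    obtain ⟨c, hc, hs⟩ := hs
    refine hT.eventually (p := fun t => ∑ l ∈ Finset.range (⌊t⌋₊ + 1), s l * (dimHarm d l / S)
      ≤ Real.exp ((γ + ε) * Y t)) ?_
    -- Constants and powers of t become C + A log t in the exponent and, with κ t^β, are swallowed
    -- by εY.
    filter_upwards [eventually_ge_atTop 1, hY (Real.log (C * (1 + c))) (d + |a|) ε hε] with t h1 h2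
    have ht : 0 < t := zero_lt_one.trans_le h1
    set Q := Real.exp (γ * Y t + κ * t ^ β) with hQ
    refine (hCb t h1 (c * t ^ |a| * Q) (by positivity) (hs t h1)).trans ?_
    have hQ1 : 1 ≤ Q := by
      rw [hQ, Real.one_le_exp_iff]
      have := hY0 t h1
      positivity
    have hp1 : 1 ≤ t ^ d * t ^ |a| := by
      have e1 : 1 ≤ t ^ d := one_le_pow₀ h1
      have e2 : 1 ≤ t ^ |a| := Real.one_le_rpow h1 (abs_nonneg _)
      exact one_le_mul_of_one_le_of_one_le e1 e2
    have h3 : 1 ≤ t ^ d * t ^ |a| * Q := one_le_mul_of_one_le_of_one_le hp1 hQ1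
    calc C * (1 + t ^ d * (c * t ^ |a| * Q)) ≤ C * (1 + c) * (t ^ d * t ^ |a| * Q) := by
          nlinarith [mul_le_mul_of_nonneg_left h3 hC.le]
      _ = Real.exp (Real.log (C * (1 + c)) + (d + |a|) * Real.log t + (γ * Y t + κ * t ^ β)) := by
          rw [Real.exp_add, Real.exp_add, Real.exp_log (by positivity), mul_comm (_ + _) (Real.log t),
            ← Real.rpow_def_of_pos ht, Real.rpow_add ht, Real.rpow_natCast]
          ring
      _ ≤ _ := Real.exp_le_exp.2 (by linarith)
  · intro ε hε
    -- With η = m^(1/β), so that η^β = m, the loss from η < 1 is at most (ε/2)Y; the other ε/2 pays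
    -- for the lower-order terms. The maximum with 1/2 keeps m positive.
    set m : ℝ := max (1 / 2) (1 - ε / (4 * γ)) with hm
    have hm0 : 0 < m := lt_of_lt_of_le (by norm_num) (le_max_left _ _)
    have hm1 : m < 1 := max_lt (by norm_num) (by have : 0 < ε / (4 * γ) := by positivity
                                                 linarith)
    have hm2 : 2 * γ - ε / 2 ≤ 2 * γ * m := by
      have : 1 - ε / (4 * γ) ≤ m := le_max_right _ _
      calc 2 * γ - ε / 2 = 2 * γ * (1 - ε / (4 * γ)) := by field_simp; ring
        _ ≤ _ := by gcongr
    have hη : (m ^ β⁻¹) ^ β = m := Real.rpow_inv_rpow hm0.le hβ.ne'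
    have hO := hM (m ^ β⁻¹) (Real.rpow_pos_of_pos hm0 _)
      (Real.rpow_lt_one hm0.le hm1 (inv_pos.2 hβ))
    rw [hη] at hO
    obtain ⟨c, hc, hO⟩ := hO.exists_pos
    filter_upwards [hO.bound, hT.eventually_ge_atTop 1,
      hT.eventually (hY (Real.log c) (-(2 * a + q)) (ε / 2) (by positivity))] with n h1 h2 h3
    have ht : 0 < T n := zero_lt_one.trans_le h2
    rw [Real.norm_of_nonneg (by positivity), Real.norm_of_nonneg (hM0 n)] at h1
    refine le_trans ?_ ((div_le_iff₀' hc).2 h1)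
    rw [Real.rpow_def_of_pos ht, ← Real.exp_add, ← Real.exp_log hc, ← Real.exp_sub]
    refine Real.exp_le_exp.2 ?_
    have := mul_le_mul_of_nonneg_right hm2 (hY0 _ h2)
    simp only [Function.comp]
    nlinarith

theorem eventually_log_le_rpow {β : ℝ} (hβ : 0 < β) (C A ε : ℝ) (hε : 0 < ε) :
    ∀ᶠ t : ℝ in atTop, C + A * Real.log t ≤ ε * t ^ β := by
  have h1 : (fun t : ℝ => C + A * Real.log t) =o[atTop] fun t : ℝ => t ^ β := by
    refine IsLittleO.add ?_ ((isLittleO_log_rpow_atTop hβ).const_mul_left A)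
    exact isLittleO_const_left.2 (Or.inr (tendsto_norm_atTop_atTop.comp (tendsto_rpow_atTop hβ)))
  filter_upwards [h1.def hε, eventually_ge_atTop 0] with t h2 h3
  rw [Real.norm_of_nonneg (Real.rpow_nonneg h3 _)] at h2
  exact (le_abs_self _).trans h2

theorem rpow_le_rpow_abs {t a : ℝ} {l : ℕ} (hl : 1 ≤ l) (hlt : (l : ℝ) ≤ t) :
    (l : ℝ) ^ a ≤ t ^ |a| := by
  have h1 : (1 : ℝ) ≤ l := by exact_mod_cast hl
  exact (Real.rpow_le_rpow_of_exponent_le h1 (le_abs_self a)).trans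
    (Real.rpow_le_rpow (by linarith) hlt (abs_nonneg a))

theorem isBigO_rpow_of_isBigO {T g : ℕ → ℝ} {β : ℝ} (hβ : 0 < β)
    (hg : ∀ᶠ n in atTop, 0 ≤ g n) (hT : T =O[atTop] fun n => g n ^ (1 / β)) :
    (fun n => T n ^ β) =O[atTop] g := by
  have h := hT.rpow hβ.le (by filter_upwards [hg] with n h using Real.rpow_nonneg h _)
  refine h.congr' EventuallyEq.rfl ?_
  filter_upwards [hg] with n hn
  rw [one_div, Real.rpow_inv_rpow hn hβ.ne']

theorem eventually_log_natCast_ge (c : ℝ) : ∀ᶠ n : ℕ in atTop, c ≤ Real.log n :=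
  (Real.tendsto_log_atTop.comp tendsto_natCast_atTop_atTop).eventually_ge_atTop c

/-- The truncation speed gives log T_n ≲ log log n, which exactly compensates the log log n in its
denominator. -/
theorem SpeedLogSuper.isBigO_mul_log {β : ℝ} (hβ : 0 < β) {T : ℕ → ℝ} (hT0 : ∀ n, 0 < T n)
    (hTt : Tendsto T atTop atTop) (hT : SpeedLogSuper β T) :
    (fun n => T n ^ β * Real.log (T n)) =O[atTop] fun n : ℕ => Real.log n := by
  have hll : Tendsto (fun n : ℕ => Real.log (Real.log n)) atTop atTop :=
    Real.tendsto_log_atTop.comp (Real.tendsto_log_atTop.comp tendsto_natCast_atTop_atTop)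
  have h1 := isBigO_rpow_of_isBigO hβ (by
    filter_upwards [hll.eventually_ge_atTop 0, eventually_log_natCast_ge 0] with n h1 h2
    exact div_nonneg h2 h1) hT
  obtain ⟨K, hK, h1⟩ := h1.exists_pos
  have h2 : (fun n => Real.log (T n)) =O[atTop] fun n : ℕ => Real.log (Real.log n) := by
    refine IsBigO.of_bound (2 / β) ?_
    filter_upwards [h1.bound, hTt.eventually_ge_atTop 1, hll.eventually_ge_atTop 1,
      eventually_log_natCast_ge 1, hll.eventually_ge_atTop (Real.log K)] with n h3 h4 h5 h6 h7
    have hTb : 0 < T n ^ β := Real.rpow_pos_of_pos (hT0 n) _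
    have hd : 0 ≤ Real.log n / Real.log (Real.log n) := div_nonneg (by linarith) (by linarith)
    rw [Real.norm_of_nonneg hTb.le, Real.norm_of_nonneg hd] at h3
    have h8 : T n ^ β ≤ K * Real.log n := h3.trans
      (mul_le_mul_of_nonneg_left (div_le_self (by linarith) h5) hK.le)
    have h9 := Real.log_le_log hTb h8
    rw [Real.log_rpow (hT0 n), Real.log_mul hK.ne' (by linarith)] at h9
    rw [Real.norm_of_nonneg (Real.log_nonneg h4), Real.norm_of_nonneg (by linarith),
      div_mul_eq_mul_div, le_div_iff₀ hβ]
    linarith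
  refine (h1.isBigO.mul h2).congr' EventuallyEq.rfl ?_
  filter_upwards [hll.eventually_gt_atTop 0] with n hn
  exact div_mul_cancel₀ _ hn.ne'

theorem tendsto_of_scenario_ordinary {d : ℕ} (hd : 1 ≤ d) {s M : ℕ → ℝ} {S : ℝ} (hS : 0 < S)
    (hs0 : ∀ l, 0 ≤ s l) (hM0 : ∀ n, 0 ≤ M n) {T : ℕ → ℝ} (hT : Tendsto T atTop atTop)
    {β q : ℝ} (hβ : 0 < β) (hs : OrdinarySmooth s β) (hq : 0 ≤ q) (hqd : q ≤ d)
    (hM : (fun n => T n ^ (2 * β + q)) =O[atTop] M) (hTs : SpeedOrdinary d q T) :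
    Tendsto M atTop atTop ∧ Tendsto (fun n : ℕ =>
      (∑ l ∈ Finset.range (⌊T n⌋₊ + 1), s l * (dimHarm d l / S)) ^ 2 / (n * M n)) atTop (𝓝 0) := by
  obtain ⟨C, hC, hCb⟩ := exists_sum_mul_dimHarm_le hd s hS
  obtain ⟨-, c, hc, hs⟩ := hs
  obtain ⟨c', hc', hM⟩ := hM.exists_pos
  obtain ⟨p, hp, hpq, hTp⟩ := hTs
  have hd' : (1 : ℝ) ≤ d := by exact_mod_cast hd
  have hdq : 0 < 2 * (d : ℝ) - q := by linarith
  rw [lt_div_iff₀ hdq] at hpq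
  have hMT : ∀ᶠ n in atTop, T n ^ (2 * β + q) / c' ≤ M n := by
    filter_upwards [hM.bound, hT.eventually_ge_atTop 0] with n h1 h2
    rw [Real.norm_of_nonneg (Real.rpow_nonneg h2 _), Real.norm_of_nonneg (hM0 n)] at h1
    exact (div_le_iff₀' hc').2 h1
  refine ⟨tendsto_atTop_mono' _ hMT (((tendsto_rpow_atTop (by linarith)).comp hT).atTop_div_const
    hc'), ?_⟩
  -- Substituting T_n ≤ K n^p into T_n^(2d-q)/n yields the exponent p(2d-q) - 1, which is negative
  -- by the condition on p.
  obtain ⟨K, hK, hTK⟩ := hTp.isBigO.exists_pos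
  have hlim : Tendsto (fun n : ℕ => (C * (1 + c)) ^ 2 * c' * K ^ (2 * (d : ℝ) - q) *
      (n : ℝ) ^ (-(1 - p * (2 * d - q)))) atTop (𝓝 0) := by
    have := ((tendsto_rpow_neg_atTop (y := 1 - p * (2 * d - q)) (by linarith)).comp
      tendsto_natCast_atTop_atTop).const_mul ((C * (1 + c)) ^ 2 * c' * K ^ (2 * (d : ℝ) - q))
    simpa using this
  refine squeeze_zero' (Eventually.of_forall fun n => div_nonneg (sq_nonneg _)
    (mul_nonneg (Nat.cast_nonneg _) (hM0 n))) ?_ hlim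
  filter_upwards [hMT, hT.eventually_ge_atTop 1, hTK.bound, eventually_gt_atTop 0]
    with n h1 h2 h3 h4
  have hn : (0 : ℝ) < n := by exact_mod_cast h4
  have ht : 0 < T n := zero_lt_one.trans_le h2
  rw [Real.norm_of_nonneg ht.le, Real.norm_of_nonneg (by positivity)] at h3
  set b := ∑ l ∈ Finset.range (⌊T n⌋₊ + 1), s l * (dimHarm d l / S) with hb
  have hb0 : 0 ≤ b := Finset.sum_nonneg fun l _ => mul_nonneg (hs0 l) (by positivity)
  have hb1 : b ≤ C * (1 + c) * T n ^ ((d : ℝ) + β) := by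
    have h5 := hCb (T n) h2 (c * T n ^ β) (by positivity) fun l hl hlT => (hs l hl).trans
      (mul_le_mul_of_nonneg_left (Real.rpow_le_rpow (Nat.cast_nonneg _) hlT hβ.le) hc.le)
    refine h5.trans ?_
    have h6 : 1 ≤ T n ^ ((d : ℝ) + β) := Real.one_le_rpow h2 (by linarith)
    have h7 : T n ^ d * (c * T n ^ β) = c * T n ^ ((d : ℝ) + β) := by
      rw [Real.rpow_add ht, Real.rpow_natCast]; ring
    rw [h7]
    nlinarith [mul_le_mul_of_nonneg_left h6 hC.le]
  have hMp : 0 < T n ^ (2 * β + q) / c' := by positivity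
  calc b ^ 2 / (n * M n)
      ≤ (C * (1 + c) * T n ^ ((d : ℝ) + β)) ^ 2 / (n * (T n ^ (2 * β + q) / c')) := by gcongr
    _ = (C * (1 + c)) ^ 2 * c' * T n ^ (2 * (d : ℝ) - q) * (n : ℝ)⁻¹ := by
        have e1 : (T n ^ ((d : ℝ) + β)) ^ 2 = T n ^ (2 * (d : ℝ) - q) * T n ^ (2 * β + q) := by
          rw [← Real.rpow_natCast, ← Real.rpow_mul ht.le, ← Real.rpow_add ht]
          congr 1
          push_cast
          ring
        have := (Real.rpow_pos_of_pos ht (2 * β + q)).ne'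
        rw [mul_pow, e1]
        field_simp
    _ ≤ (C * (1 + c)) ^ 2 * c' * (K * (n : ℝ) ^ p) ^ (2 * (d : ℝ) - q) * (n : ℝ)⁻¹ := by
        gcongr
    _ = _ := by
        rw [Real.mul_rpow hK.le (by positivity), ← Real.rpow_mul hn.le, neg_sub,
          Real.rpow_sub_one hn.ne']
        ring

theorem tendsto_of_scenario_super {d : ℕ} (hd : 1 ≤ d) {s M : ℕ → ℝ} {S : ℝ} (hS : 0 < S)
    (hs0 : ∀ l, 0 ≤ s l) (hM0 : ∀ n, 0 ≤ M n) {T : ℕ → ℝ} (hT0 : ∀ n, 0 < T n)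
    (hT : Tendsto T atTop atTop) {β γ α q : ℝ} (hs : SuperSmooth s β γ α)
    (hM : ∀ η : ℝ, 0 < η → η < 1 →
      (fun n => T n ^ (2 * α + q) * Real.exp (2 * γ * (η * T n) ^ β)) =O[atTop] M)
    (hTs : SpeedSuper β T) :
    Tendsto M atTop atTop ∧ Tendsto (fun n : ℕ =>
      (∑ l ∈ Finset.range (⌊T n⌋₊ + 1), s l * (dimHarm d l / S)) ^ 2 / (n * M n)) atTop (𝓝 0) := by
  obtain ⟨hβ, hγ, c, hc, hs⟩ := hs
  refine tendsto_of_superSmooth hd hS hs0 hM0 hT (Y := fun t => t ^ β) (a := α) (q := q) (κ := 0)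
    hβ hγ le_rfl (fun t ht => by positivity) ?_ ⟨c, hc, fun t ht l hl hlt => ?_⟩ ?_ ?_
  · intro C A ε hε
    simpa using eventually_log_le_rpow hβ C A ε hε
  · refine (hs l hl).trans ?_
    have := rpow_le_rpow_abs (a := α) hl hlt
    rw [zero_mul, add_zero]
    gcongr
  · intro η h0 h1
    refine (hM η h0 h1).congr_left fun n => ?_
    rw [Real.mul_rpow h0.le (hT0 n).le]
    ring_nf
  · exact isBigO_rpow_of_isBigO hβ (eventually_log_natCast_ge 0) hTs

theorem tendsto_of_scenario_logSuper {d : ℕ} (hd : 1 ≤ d) {s M : ℕ → ℝ} {S : ℝ} (hS : 0 < S)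
    (hs0 : ∀ l, 0 ≤ s l) (hM0 : ∀ n, 0 ≤ M n) {T : ℕ → ℝ} (hT0 : ∀ n, 0 < T n)
    (hT : Tendsto T atTop atTop) {β γ α ξ q ζ : ℝ} (hs : LogSuperSmooth s β γ α ξ)
    (hM : ∀ η : ℝ, 0 < η → η < 1 → (fun n => T n ^ (2 * α + q) *
      Real.exp (2 * γ * (η * T n) ^ β * (Real.log (T n) - ζ))) =O[atTop] M)
    (hTs : SpeedLogSuper β T) :
    Tendsto M atTop atTop ∧ Tendsto (fun n : ℕ =>
      (∑ l ∈ Finset.range (⌊T n⌋₊ + 1), s l * (dimHarm d l / S)) ^ 2 / (n * M n)) atTop (𝓝 0) := by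
  obtain ⟨hβ, hγ, c, hc, hs⟩ := hs
  -- Large enough to absorb both shifts ξ and ζ as multiples of t^β, which are negligible against
  -- t^β log t.
  set κ : ℝ := γ * |ξ| + 2 * γ * |ζ| with hκ
  have hκ0 : 0 ≤ κ := by positivity
  refine tendsto_of_superSmooth hd hS hs0 hM0 hT (Y := fun t => t ^ β * Real.log t) (a := α)
    (q := q) (κ := κ) hβ hγ hκ0
    (fun t ht => mul_nonneg (by positivity) (Real.log_nonneg ht)) ?_
    ⟨c, hc, fun t ht l hl hlt => ?_⟩ ?_ (hTs.isBigO_mul_log hβ hT0 hT)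
  · intro C A ε hε
    filter_upwards [eventually_log_le_rpow hβ C A 1 one_pos, eventually_ge_atTop 0,
      Real.tendsto_log_atTop.eventually_ge_atTop ((1 + κ) / ε)] with t h1 h2 h3
    rw [div_le_iff₀' hε] at h3
    have := mul_le_mul_of_nonneg_left h3 (Real.rpow_nonneg h2 β)
    linarith
  · refine (hs l hl).trans ?_
    have h1 : (1 : ℝ) ≤ l := by exact_mod_cast hl
    have hp := rpow_le_rpow_abs (a := α) hl hlt
    have hβl : (l : ℝ) ^ β ≤ t ^ β := Real.rpow_le_rpow (by linarith) hlt hβ.le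
    have hlog : Real.log l ≤ Real.log t := Real.log_le_log (by linarith) hlt
    have hl0 : 0 ≤ (l : ℝ) ^ β := by positivity
    have hlog0 : 0 ≤ Real.log l := Real.log_nonneg h1
    have e1 : (l : ℝ) ^ β * Real.log l ≤ t ^ β * Real.log t := by gcongr
    -- The two parts of l^β (log l - ξ) are bounded separately, because the product need not be
    -- monotone in l.
    have e2 : (l : ℝ) ^ β * (-ξ) ≤ t ^ β * |ξ| :=
      (mul_le_mul_of_nonneg_left (neg_le_abs ξ) hl0).trans
        (mul_le_mul_of_nonneg_right hβl (abs_nonneg _))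
    have e3 : 0 ≤ 2 * γ * |ζ| * t ^ β := by positivity
    have : γ * (l : ℝ) ^ β * (Real.log l - ξ) ≤ γ * (t ^ β * Real.log t) + κ * t ^ β := by
      rw [hκ]
      nlinarith [mul_le_mul_of_nonneg_left (add_le_add e1 e2) hγ.le]
    gcongr
  · intro η h0 h1
    refine IsBigO.trans (IsBigO.of_bound 1 ?_) (hM η h0 h1)
    filter_upwards [hT.eventually_ge_atTop 1] with n hn
    have hT' := hT0 n
    rw [one_mul, Real.norm_of_nonneg (by positivity), Real.norm_of_nonneg (by positivity),
      Real.mul_rpow h0.le hT'.le]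
    have hη : η ^ β ≤ 1 := Real.rpow_le_one h0.le h1.le hβ.le
    have hη0 : 0 ≤ η ^ β := by positivity
    have e1 : η ^ β * ζ ≤ |ζ| := by
      calc η ^ β * ζ ≤ η ^ β * |ζ| := by gcongr; exact le_abs_self _
        _ ≤ 1 * |ζ| := by gcongr
        _ = |ζ| := one_mul _
    have e2 : 0 ≤ γ * T n ^ β := by positivity
    have e3 : 0 ≤ γ * |ξ| * T n ^ β := by positivity
    have : 2 * γ * η ^ β * (T n ^ β * Real.log (T n)) - κ * T n ^ β
        ≤ 2 * γ * (η ^ β * T n ^ β) * (Real.log (T n) - ζ) := by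
      rw [hκ]
      nlinarith [mul_le_mul_of_nonneg_left e1 e2]
    gcongr

end SphereDeconvolution

end

/-! ### Assembly of the limit theorem -/

open SphereDeconvolution in
theorem mainTheorem2
    (d : ℕ) (hd : 1 ≤ d)
    -- an orthonormal basis of spherical harmonics in each degree
    (B : (l : ℕ) → Fin (dimHarm d l) → Sph d → ℂ) (hB : ∀ l, IsHarmonicONB d l (B l))
    -- the model `Z = U X`
    {Ω : Type*} [MeasurableSpace Ω] (P : Measure Ω) [IsProbabilityMeasure P]
    (X : Ω → Sph d) (U : Ω → SO d) (hX : Measurable X) (hU : Measurable U)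
    (hUX : IndepFun U X P)
    -- square integrable densities of `X` and `U`
    (fX : Sph d → ℝ) (hfX_meas : Measurable fX) (hfX_nonneg : ∀ x, 0 ≤ fX x)
    (hfX_dens : P.map X = (nu d).withDensity fun x => ENNReal.ofReal (fX x))
    (hfX_sq : MemLp fX 2 (nu d))
    (fU : SO d → ℝ) (hfU_meas : Measurable fU) (hfU_nonneg : ∀ u, 0 ≤ fU u)
    (hfU_dens : P.map U = (muSO d).withDensity fun u => ENNReal.ofReal (fU u))
    (hfU_sq : MemLp fU 2 (muSO d))
    (hfU_inv : ∀ l, IsUnit (rotFourier d B (fun u => (fU u : ℂ)) l))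
    -- i.i.d. observations distributed as `Z = U X`
    (Z : Ω → Sph d) (hZ : ∀ ω, Z ω = rot (U ω) (X ω))
    (Zobs : ℕ → Ω → Sph d) (hZobs_indep : iIndepFun Zobs P)
    (hZobs_law : ∀ i, IdentDistrib (Zobs i) Z P P)
    -- the truncation level
    (T : ℕ → ℝ) (hT_pos : ∀ n, 0 < T n) (hT : Tendsto T atTop atTop)
    -- pointwise convergence of the Fourier-Laplace series
    (hFL : FourierLaplaceConverges d B fX)
    -- one of the three scenarios
    (hscenario :
      (∃ β q : ℝ, OrdinarySmooth (invNorm d B fU) β ∧ 0 ≤ q ∧ q ≤ d ∧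
        LowerOrdinary (secondMoment d B fU P Z T) T β q ∧ SpeedOrdinary d q T) ∨
      (∃ β γ α q : ℝ, SuperSmooth (invNorm d B fU) β γ α ∧ 0 ≤ q ∧ q ≤ d ∧
        LowerSuper (secondMoment d B fU P Z T) T β γ α q ∧ SpeedSuper β T) ∨
      (∃ β γ α ξ q ζ : ℝ, LogSuperSmooth (invNorm d B fU) β γ α ξ ∧ 0 ≤ q ∧ q ≤ d ∧
        LowerLogSuper (secondMoment d B fU P Z T) T β γ α q ζ ∧ SpeedLogSuper β T))
    (x : Sph d) :
    TendstoInDistribution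
      (fun (n : ℕ) (ω : Ω) =>
        √(n : ℝ) *
          ((fhat d B fU (T n) n (fun i => Zobs i ω) x - fX x
              - ((∫ ω', (kernelK d B fU (T n) x (Z ω')).re ∂P) - fX x))
            / √(variance (fun ω' => (kernelK d B fU (T n) x (Z ω')).re) P)))
      atTop id (fun _ => P) (gaussianReal 0 1) := by
  have hZ_eq : Z = fun ω => rot (U ω) (X ω) := funext hZ
  have hZm : Measurable Z := by
    rw [hZ_eq]
    exact continuous_rot.measurable.comp (hU.prodMk hX)
  set S := (nu d).real Set.univ with hS
  have hS0 : 0 < S := nu_univ_pos d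
  set g : ℕ → Sph d → ℝ := fun n z => (kernelK d B fU (T n) x z).re with hg
  have hKc : ∀ n, Continuous (kernelK d B fU (T n) x) := fun n => continuous_kernelK hB _ _ _
  have hgc : ∀ n, Continuous (g n) := fun n => Complex.continuous_re.comp (hKc n)
  set b : ℕ → ℝ := fun n => ∑ l ∈ Finset.range (⌊T n⌋₊ + 1), invNorm d B fU l * (dimHarm d l / S)
    with hb
  have hKb : ∀ n z, ‖kernelK d B fU (T n) x z‖ ≤ b n := fun n z => norm_kernelK_le hd hB _ _ _ _
  have hgb : ∀ n z, |g n z| ≤ b n := fun n z => (Complex.abs_re_le_norm _).trans (hKb n z)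
  have hmean : Tendsto (fun n => ∫ ω, g n (Z ω) ∂P) atTop (𝓝 (fX x)) := by
    have hK : ∀ n, ∫ ω, g n (Z ω) ∂P = (∑ l ∈ Finset.range (⌊T n⌋₊ + 1),
        ∑ q, sphFourier d B (fun y => (fX y : ℂ)) l q * B l q x).re := fun n => by
      rw [← integral_kernelK hB hX hU hUX hfX_meas hfX_nonneg hfX_dens hfU_meas hfU_nonneg
        hfU_dens hfU_inv (T n) x, hZ_eq]
      refine integral_re (𝕜 := ℂ) (Integrable.of_bound (C := b n) ?_ (ae_of_all _ fun ω => hKb n _))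
      rw [hZ_eq] at hZm
      exact ((hKc n).measurable.comp hZm).aestronglyMeasurable
    -- The truncation indices tend to infinity, so pointwise convergence of the series passes to the
    -- means.
    have hfl : Tendsto (fun n => ⌊T n⌋₊ + 1) atTop atTop :=
      (tendsto_add_atTop_nat 1).comp (tendsto_nat_floor_atTop.comp hT)
    have := (Complex.continuous_re.tendsto _).comp ((hFL x).comp hfl)
    exact this.congr fun n => (hK n).symm
  have hs0 : ∀ l, 0 ≤ invNorm d B fU l := fun l => opNorm_nonneg _
  have hM0 : ∀ n, 0 ≤ secondMoment d B fU P Z T x n := fun n =>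
    integral_nonneg fun _ => sq_nonneg _
  obtain ⟨hM, hr⟩ : Tendsto (secondMoment d B fU P Z T x) atTop atTop ∧
      Tendsto (fun n : ℕ => b n ^ 2 / (n * secondMoment d B fU P Z T x n)) atTop (𝓝 0) := by
    rcases hscenario with ⟨β, q, hs, hq, hqd, hlow, hsp⟩ | ⟨β, γ, α, q, hs, hq, hqd, hlow, hsp⟩ |
      ⟨β, γ, α, ξ, q, ζ, hs, hq, hqd, hlow, hsp⟩
    -- For β = 0 the smoothness condition would bound the inverse norms, which square integrability
    -- of f_U forbids.
    · have hβ : 0 < β := hs.1.lt_of_ne' fun h => by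
        obtain ⟨-, c, -, hc⟩ := hs
        refine not_bddAbove_invNorm hd hB hfU_sq hfU_inv c fun l hl => ?_
        simpa [h] using hc l hl
      exact tendsto_of_scenario_ordinary hd hS0 hs0 hM0 hT hβ hs hq hqd (hlow x) hsp
    · exact tendsto_of_scenario_super hd hS0 hs0 hM0 hT_pos hT hs (hlow x) hsp
    · exact tendsto_of_scenario_logSuper hd hS0 hs0 hM0 hT_pos hT hs (hlow x) hsp
  have hclt := tendstoInDistribution_row_sum hZobs_indep hZobs_law hZm
    (fun n => (hgc n).measurable) hgb hmean hM hr
  refine hclt.congr (fun n => ae_of_all _ fun ω => ?_) EventuallyEq.rfl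
  -- At n = 0 both expressions vanish; otherwise f_X(x) cancels and √n · n⁻¹ = (√n)⁻¹ matches the
  -- scalings.
  rcases Nat.eq_zero_or_pos n with rfl | hn
  · simp
  · have hn' : (0 : ℝ) < n := by exact_mod_cast hn
    have hsq : √(n : ℝ) * √(n : ℝ) = n := Real.mul_self_sqrt hn'.le
    have hsn : √(n : ℝ) ≠ 0 := (Real.sqrt_pos.2 hn').ne'
    have hinv : (√(n : ℝ))⁻¹ = √(n : ℝ) * (n : ℝ)⁻¹ := by
      rw [inv_eq_iff_eq_inv, mul_inv, inv_inv, eq_inv_mul_iff_mul_eq₀ hsn, hsq]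
    simp only [fhat, sub_sub_sub_cancel_right]
    rw [Finset.sum_sub_distrib, Finset.sum_const, Finset.card_range, nsmul_eq_mul, mul_inv, hinv]
    field_simp
    simp only [hg]
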